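/- Let $(N,c,D)$ be a Weyl space, $\dim N=n$ (that is, $c$ is a conformal structure on the smooth manifold $N$ and $D$ is a torsion free connection preserving $c$), and let $1\le r<\tfrac12 n$. Let $\pi:Q_{N,r}\to N$ be the bundle of complex $r$-dimensional isotropic subspaces of $(T^{\mathbb C}N,c)$. The fibres of $\pi$ are complex submanifolds of Grassmannians, and $D$ induces a connection $\mathscr H\subseteq TQ_{N,r}$. Let $\mathcal J'_{N,r}$ be the almost CR-structure on $Q_{N,r}$ whose eigenbundle corresponding to $-\mathrm i$ is $\mathscr G_0\oplus(\ker d\pi)^{1,0}$, where $\mathscr G_0\subseteq\mathscr H^{\mathbb C}$ is characterised by $d\pi\bigl((\mathscr G_0)_q\bigr)=q$ for any $q\in Q_{N,r}$. Let $M\subseteq N$ be a submanifold, $\dim M=2r$, with inclusion $\iota$, let $c_M=c|_M$, and let $D^M$ be the connection on $M$ induced by $D$ (the tangential part of $D$), which is a Weyl connection on $(M,c_M)$. Let $p$ be a smooth section over $M$ of $Q_{N,r}$ which is tangent to $M$, that is, $p_x\subseteq T^{\mathbb C}_xM$ for any $x\in M$. Denote by $J^p$ the almost Hermitian structure on $(M,c_M)$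 whose eigenbundle corresponding to $-\mathrm i$ is $p$, and suppose $M$ oriented such that $J^p$ is positive. Let $Q_M$ be the bundle of positive maximal isotropic spaces on $(M,c_M)$ (the eigenspaces corresponding to $-\mathrm i$ of the positive orthogonal complex structures), so that $p$ is also a section of $Q_M$, and let $\mathcal J'_M$ be the almost complex structure on $Q_M$ whose eigenbundle corresponding to $-\mathrm i$ is defined, as above, by using $D^M$. A map from $(M,J^p)$ to a manifold endowed with an almost CR-structure is called holomorphic if its differential maps the eigenbundle of $J^p$ corresponding to $-\mathrm i$ into the eigenbundle of the almost CR-structure corresponding to $-\mathrm i$. Also, $(M,J^p)$ is called $(1,1)$-geodesic if the $(1,1)$-part, with respect to $J^p$, of the second fundamental form $b(X,Y)=D_XY-D^M_XY$ is zero; that is, $b(X,Y)+b(J^pX,J^pY)=0$ for any $X,Y\in TM$. Then the following assertions are equivalent: (i) $p:(M,J^p)\to(Q_{N,r},\mathcal J'_{N,r})$ is holomorphic. (ii) $(M,J^p)$ is a $(1,1)$-geodesic submanifold of $(N,c,D)$ and $p:(M,J^p)\to(Q_M,\mathcal J'_M)$ is holomorphic. -/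

import Mathlib

open Bundle FiberBundle
open scoped Manifold ContDiff Topology TensorProduct

noncomputable section


namespace WeylTwistor

section LinearAlgebra

variable {V W : Type*} [AddCommGroup V] [Module ℝ V] [TopologicalSpace V]
  [AddCommGroup W] [Module ℝ W] [TopologicalSpace W]

/-- The complex-linear extension `ℂ ⊗ V → ℂ ⊗ W` of a real-linear map. -/
def cx (f : V →L[ℝ] W) : ℂ ⊗[ℝ] V →ₗ[ℂ] ℂ ⊗[ℝ] W :=
  (f : V →ₗ[ℝ] W).baseChange ℂ

/-- The eigenspace, corresponding to `-i`, of the complexification of a real endomorphism. -/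
def minusI (F : V →L[ℝ] V) : Submodule ℂ (ℂ ⊗[ℝ] V) :=
  Module.End.eigenspace (cx F) (-Complex.I)

/-- `A` is skew-adjoint with respect to the conformal class of bilinear forms `c`. -/
def IsSkew (c : Set (V →L[ℝ] V →L[ℝ] ℝ)) (A : V →L[ℝ] V) : Prop :=
  ∀ b ∈ c, ∀ v w, b (A v) w + b v (A w) = 0

/-- A complex subspace of `ℂ ⊗ V` is isotropic if the complex-bilinear extensions of the
forms in the conformal class `c` vanish on it. -/
def IsIsotropic (c : Set (V →L[ℝ] V →L[ℝ] ℝ)) (q : Submodule ℂ (ℂ ⊗[ℝ] V)) : Prop :=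
  ∀ b ∈ c, ∀ v ∈ q, ∀ w ∈ q,
    LinearMap.BilinForm.baseChange ℂ (ContinuousLinearMap.toBilinForm b) v w = 0

/-- `F` is the skew-adjoint `f`-structure on `(V, c)` whose eigenspace corresponding to `-i`
is `q`. -/
def IsFStructureOf (c : Set (V →L[ℝ] V →L[ℝ] ℝ)) (q : Submodule ℂ (ℂ ⊗[ℝ] V))
    (F : V →L[ℝ] V) : Prop :=
  IsSkew c F ∧ (∀ v, F (F (F v)) + F v = 0) ∧ minusI F = q

open Classical in
/-- The skew-adjoint `f`-structure on `(V, c)` whose eigenspace corresponding to `-i` is the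
isotropic space `q`; it exists and is unique by `existsUnique_isFStructureOf`. -/
def fStructure (c : Set (V →L[ℝ] V →L[ℝ] ℝ)) (q : Submodule ℂ (ℂ ⊗[ℝ] V)) : V →L[ℝ] V :=
  if h : ∃ F, IsFStructureOf c q F then h.choose else 0

/-- `c` consists of the positive multiples of one inner product. -/
def IsConformalClass (c : Set (V →L[ℝ] V →L[ℝ] ℝ)) : Prop :=
  ∃ g : V →L[ℝ] V →L[ℝ] ℝ, (∀ v w, g v w = g w v) ∧ (∀ v, v ≠ 0 → 0 < g v v) ∧
    c = {b | ∃ t : ℝ, 0 < t ∧ b = t • g}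

/-- Orthogonal projection on a subspace, given as the image of an injective linear map. -/
theorem exists_orthogonal_projection {U : Type*} [AddCommGroup U] [Module ℝ U]
    [FiniteDimensional ℝ U] (g : V →L[ℝ] V →L[ℝ] ℝ) (hs : ∀ v w, g v w = g w v)
    (hp : ∀ v, v ≠ 0 → 0 < g v v) (L : U →ₗ[ℝ] V) (hL : Function.Injective L) :
    ∃ P : V →ₗ[ℝ] U, (∀ u, P (L u) = u) ∧ ∀ w u, g (w - L (P w)) (L u) = 0 := by
  let h : LinearMap.BilinForm ℝ U := (ContinuousLinearMap.toBilinForm g).comp L L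
  have hh : ∀ u u', h u u' = g (L u) (L u') := fun u u' => rfl
  have hnd : h.Nondegenerate := by
    have key : ∀ u, (∀ u', g (L u) (L u') = 0) → u = 0 := by
      intro u hu
      by_contra hne
      have : L u ≠ 0 := fun h0 => hne (hL (by simpa using h0))
      exact (hp _ this).ne' (hu u)
    refine ⟨fun u hu => key u hu, fun u hu => key u fun u' => ?_⟩
    rw [hs]; exact hu u'
  let e := LinearMap.BilinForm.toDual h hnd
  let T : V →ₗ[ℝ] Module.Dual ℝ U :=
    (LinearMap.compl₂ (ContinuousLinearMap.toBilinForm g) L)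
  refine ⟨e.symm.toLinearMap ∘ₗ T, fun u => ?_, fun w u => ?_⟩
  · apply e.injective
    ext u'
    simp [T, e, LinearMap.BilinForm.toDual_def, hh]
  · have h1 : e (e.symm (T w)) u = T w u := by rw [LinearEquiv.apply_symm_apply]
    rw [LinearMap.BilinForm.toDual_def, hh] at h1
    have h2 : T w u = g w (L u) := rfl
    simp only [map_sub, sub_apply, LinearMap.comp_apply,
      LinearEquiv.coe_coe]
    rw [h1, h2, sub_self]

/-- Real part of a complexified vector. -/
def reV : ℂ ⊗[ℝ] V →ₗ[ℝ] V :=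
  (TensorProduct.lid ℝ V).toLinearMap ∘ₗ LinearMap.rTensor V Complex.reLm

/-- Imaginary part of a complexified vector. -/
def imV : ℂ ⊗[ℝ] V →ₗ[ℝ] V :=
  (TensorProduct.lid ℝ V).toLinearMap ∘ₗ LinearMap.rTensor V Complex.imLm

@[simp] theorem reV_tmul (z : ℂ) (v : V) : reV (z ⊗ₜ[ℝ] v) = z.re • v := by simp [reV]
@[simp] theorem imV_tmul (z : ℂ) (v : V) : imV (z ⊗ₜ[ℝ] v) = z.im • v := by simp [imV]

theorem reV_add_imV (z : ℂ ⊗[ℝ] V) :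
    (1 : ℂ) ⊗ₜ[ℝ] reV z + Complex.I ⊗ₜ[ℝ] imV z = z := by
  induction z with
  | zero => simp
  | tmul a v =>
    rw [reV_tmul, imV_tmul, ← TensorProduct.smul_tmul, ← TensorProduct.smul_tmul,
      ← TensorProduct.add_tmul]
    congr 1
    apply Complex.ext <;> simp
  | add x y hx hy =>
    rw [map_add, map_add, TensorProduct.tmul_add, TensorProduct.tmul_add]
    nth_rewrite 3 [← hx]
    nth_rewrite 3 [← hy]
    abel

theorem reV_I_smul (z : ℂ ⊗[ℝ] V) : reV (Complex.I • z) = - imV z := by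
  induction z with
  | zero => simp
  | tmul a v => simp [TensorProduct.smul_tmul']
  | add x y hx hy => rw [smul_add, map_add, map_add, hx, hy]; abel

theorem imV_I_smul (z : ℂ ⊗[ℝ] V) : imV (Complex.I • z) = reV z := by
  induction z with
  | zero => simp
  | tmul a v => simp [TensorProduct.smul_tmul']
  | add x y hx hy => rw [smul_add, map_add, map_add, hx, hy]

theorem ext_reV_imV {z w : ℂ ⊗[ℝ] V} (h1 : reV z = reV w) (h2 : imV z = imV w) : z = w := by
  rw [← reV_add_imV z, ← reV_add_imV w, h1, h2]

theorem reV_cx (f : V →L[ℝ] W) (z : ℂ ⊗[ℝ] V) : reV (cx f z) = f (reV z) := by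
  induction z with
  | zero => simp
  | tmul a v => simp [cx]
  | add x y hx hy => simp only [map_add, hx, hy]

theorem imV_cx (f : V →L[ℝ] W) (z : ℂ ⊗[ℝ] V) : imV (cx f z) = f (imV z) := by
  induction z with
  | zero => simp
  | tmul a v => simp [cx]
  | add x y hx hy => simp only [map_add, hx, hy]

theorem mem_minusI {F : V →L[ℝ] V} {z : ℂ ⊗[ℝ] V} :
    z ∈ minusI F ↔ F (reV z) = imV z ∧ F (imV z) = - reV z := by
  rw [minusI, Module.End.mem_eigenspace_iff]
  constructor
  · intro h
    refine ⟨?_, ?_⟩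
    · rw [← reV_cx, h, neg_smul, map_neg, reV_I_smul, neg_neg]
    · rw [← imV_cx, h, neg_smul, map_neg, imV_I_smul]
  · rintro ⟨h1, h2⟩
    apply ext_reV_imV
    · rw [reV_cx, h1, neg_smul, map_neg, reV_I_smul, neg_neg]
    · rw [imV_cx, h2, neg_smul, map_neg, imV_I_smul]

theorem baseChange_re_im (b : V →L[ℝ] V →L[ℝ] ℝ) (z w : ℂ ⊗[ℝ] V) :
    LinearMap.BilinForm.baseChange ℂ (ContinuousLinearMap.toBilinForm b) z w =
      ((b (reV z) (reV w) - b (imV z) (imV w) : ℝ) : ℂ) +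
        ((b (reV z) (imV w) + b (imV z) (reV w) : ℝ) : ℂ) * Complex.I := by
  conv_lhs => rw [← reV_add_imV z, ← reV_add_imV w]
  simp only [map_add, LinearMap.add_apply, LinearMap.BilinForm.baseChange_tmul]
  simp
  ring

/-- On a finite dimensional conformal vector space, each isotropic space is the eigenspace
corresponding to `-i` of exactly one skew-adjoint `f`-structure. -/
theorem existsUnique_isFStructureOf [IsTopologicalAddGroup V] [ContinuousSMul ℝ V] [T2Space V]
    [FiniteDimensional ℝ V] {c : Set (V →L[ℝ] V →L[ℝ] ℝ)} (hc : IsConformalClass c)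
    {q : Submodule ℂ (ℂ ⊗[ℝ] V)} (hq : IsIsotropic c q) :
    ∃! F, IsFStructureOf c q F := by
  obtain ⟨g, hs, hp, rfl⟩ := hc
  have hgc : g ∈ {b | ∃ t : ℝ, 0 < t ∧ b = t • g} := ⟨1, one_pos, (one_smul _ _).symm⟩
  have hiso : ∀ z ∈ q, ∀ w ∈ q, g (reV z) (reV w) = g (imV z) (imV w) ∧
      g (reV z) (imV w) + g (imV z) (reV w) = 0 := by
    intro z hz w hw
    have h := hq g hgc z hz w hw
    rw [baseChange_re_im] at h
    have h1 := congrArg Complex.re h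
    have h2 := congrArg Complex.im h
    simp at h1 h2
    exact ⟨by linarith, by linarith⟩
  let qR : Submodule ℝ (ℂ ⊗[ℝ] V) := q.restrictScalars ℝ
  have : FiniteDimensional ℝ (ℂ ⊗[ℝ] V) := inferInstance
  let ρ : qR →ₗ[ℝ] V := reV ∘ₗ qR.subtype
  have hρ : Function.Injective ρ := by
    rw [injective_iff_map_eq_zero]
    rintro ⟨z, hz⟩ h0
    have h0' : reV z = 0 := h0
    have h1 := (hiso z hz z hz).1
    rw [h0'] at h1
    have h2 : imV z = 0 := by
      by_contra hne
      exact (hp _ hne).ne (by simpa using h1)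
    exact Subtype.ext (ext_reV_imV (by simpa using h0') (by simpa using h2))
  obtain ⟨P, hP1, hP2⟩ := exists_orthogonal_projection g hs hp ρ hρ
  have hP1' : ∀ z, ∀ hz : z ∈ q, P (reV z) = ⟨z, hz⟩ := fun z hz => hP1 ⟨z, hz⟩
  have hImem : ∀ z ∈ q, Complex.I • z ∈ q := fun z hz => q.smul_mem _ hz
  have him : ∀ z ∈ q, imV z = reV (-(Complex.I • z)) := by
    intro z hz; rw [map_neg, reV_I_smul, neg_neg]
  have hPm : ∀ v, ((P v : ℂ ⊗[ℝ] V)) ∈ q := fun v => (P v).2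
  have horth : ∀ v, ∀ z ∈ q, g v (reV z) = g (reV (P v : ℂ ⊗[ℝ] V)) (reV z) := by
    intro v z hz
    have := hP2 v ⟨z, hz⟩
    rw [map_sub, sub_apply, sub_eq_zero] at this
    exact this
  have horth' : ∀ v, ∀ z ∈ q, g v (imV z) = g (reV (P v : ℂ ⊗[ℝ] V)) (imV z) := by
    intro v z hz
    rw [him z hz]
    exact horth v _ (q.neg_mem (hImem z hz))
  let F₀ : V →ₗ[ℝ] V := imV ∘ₗ qR.subtype ∘ₗ P
  have hF₀ : ∀ v, F₀ v = imV (P v : ℂ ⊗[ℝ] V) := fun v => rfl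
  have hF₀q : ∀ z ∈ q, F₀ (reV z) = imV z ∧ F₀ (imV z) = - reV z := by
    intro z hz
    constructor
    · rw [hF₀, hP1' z hz]
    · have hm : -(Complex.I • z) ∈ q := q.neg_mem (hImem z hz)
      rw [him z hz, hF₀, hP1' _ hm]
      simp [imV_I_smul]
  let F : V →L[ℝ] V := LinearMap.toContinuousLinearMap F₀
  have hF : ∀ v, F v = F₀ v := fun v => rfl
  refine ⟨F, ⟨?_, ?_, ?_⟩, ?_⟩
  · rintro b ⟨t, ht, rfl⟩ v w
    have h1 : g (F v) w = g (imV (P v : ℂ ⊗[ℝ] V)) (reV (P w : ℂ ⊗[ℝ] V)) := by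
      rw [hF, hF₀, hs, horth' w _ (hPm v), hs]
    have h2 : g v (F w) = g (reV (P v : ℂ ⊗[ℝ] V)) (imV (P w : ℂ ⊗[ℝ] V)) := by
      rw [hF, hF₀, horth' v _ (hPm w)]
    have h3 := (hiso _ (hPm v) _ (hPm w)).2
    simp only [smul_apply, smul_eq_mul]
    rw [h1, h2, ← mul_add, add_comm, h3, mul_zero]
  · intro v
    simp only [hF]
    rw [hF₀ v, (hF₀q _ (hPm v)).2, map_neg, (hF₀q _ (hPm v)).1]
    abel
  · ext z
    rw [mem_minusI]
    constructor
    · rintro ⟨h1, h2⟩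
      have hm : Complex.I • (P (imV z) : ℂ ⊗[ℝ] V) ∈ q := hImem _ (hPm _)
      have hre : reV z = reV (Complex.I • (P (imV z) : ℂ ⊗[ℝ] V)) := by
        rw [reV_I_smul, ← hF₀, ← hF, h2, neg_neg]
      have him' : imV z = imV (Complex.I • (P (imV z) : ℂ ⊗[ℝ] V)) := by
        have h3 := (hF₀q _ hm).1
        rw [← hre] at h3
        exact h1.symm.trans h3
      rw [ext_reV_imV hre him']
      exact hm
    · intro hz
      exact hF₀q z hz
  · rintro G ⟨hG1, hG2, hG3⟩
    have hGq : ∀ z ∈ q, G (reV z) = imV z := by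
      intro z hz
      rw [← hG3, mem_minusI] at hz
      exact hz.1
    have hGm : ∀ v, ∃ z ∈ q, reV z = G (G v) := by
      intro v
      refine ⟨(1 : ℂ) ⊗ₜ[ℝ] (G (G v)) - Complex.I ⊗ₜ[ℝ] (G v), ?_, by simp⟩
      rw [← hG3, mem_minusI]
      simp
      exact eq_neg_of_add_eq_zero_left (hG2 v)
    ext v
    have hn : G (v - reV (P v : ℂ ⊗[ℝ] V)) = 0 := by
      by_contra hne
      set n := v - reV (P v : ℂ ⊗[ℝ] V) with hn
      have h1 := hG1 g hgc n (G n)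
      obtain ⟨z, hz, hz'⟩ := hGm n
      have h2 : g n (G (G n)) = 0 := by
        rw [← hz', hn]
        exact hP2 v ⟨z, hz⟩
      rw [h2, add_zero] at h1
      exact (hp _ hne).ne' h1
    rw [map_sub, sub_eq_zero] at hn
    rw [hn, hGq _ (hPm v), hF, hF₀]

theorem fStructure_spec [IsTopologicalAddGroup V] [ContinuousSMul ℝ V] [T2Space V]
    [FiniteDimensional ℝ V] {c : Set (V →L[ℝ] V →L[ℝ] ℝ)} (hc : IsConformalClass c)
    {q : Submodule ℂ (ℂ ⊗[ℝ] V)} (hq : IsIsotropic c q) :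
    IsFStructureOf c q (fStructure c q) := by
  have h := (existsUnique_isFStructureOf hc hq).exists
  rw [fStructure, dif_pos h]
  exact h.choose_spec

end LinearAlgebra

section Manifolds

variable {E : Type*} [NormedAddCommGroup E] [NormedSpace ℝ E] [FiniteDimensional ℝ E]
  {B : Type*} [TopologicalSpace B] [ChartedSpace E B] [IsManifold 𝓘(ℝ, E) ∞ B]

instance (x : B) : FiniteDimensional ℝ (TangentSpace 𝓘(ℝ, E) x) :=
  inferInstanceAs (FiniteDimensional ℝ E)

instance (x : B) : T2Space (TangentSpace 𝓘(ℝ, E) x) :=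
  inferInstanceAs (T2Space E)

variable (E B) in
/-- The total space of the vector bundle `End(TB)`, a smooth manifold. -/
abbrev EndTotal : Type _ :=
  TotalSpace (E →L[ℝ] E) (fun x : B => TangentSpace 𝓘(ℝ, E) x →L[ℝ] TangentSpace 𝓘(ℝ, E) x)

/-- The model with corners of the manifold `End(TB)`. -/
abbrev endModel (E : Type*) [NormedAddCommGroup E] [NormedSpace ℝ E] :
    ModelWithCorners ℝ (E × (E →L[ℝ] E)) (ModelProd E (E →L[ℝ] E)) :=
  (𝓘(ℝ, E)).prod 𝓘(ℝ, E →L[ℝ] E)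

variable (E B) in
/-- A Weyl space: a conformal structure (in each tangent space, the ray of positive multiples of
a smooth Riemannian metric) and a smooth torsion free connection which preserves it: for each
metric `g` in the conformal class, `D g = α ⊗ g` for some `1`-form `α`. -/
structure WeylSpace where
  conf : ∀ x : B, Set (TangentSpace 𝓘(ℝ, E) x →L[ℝ] TangentSpace 𝓘(ℝ, E) x →L[ℝ] ℝ)
  exists_metric : ∃ g : ContMDiffRiemannianMetric 𝓘(ℝ, E) ∞ E (fun x : B => TangentSpace 𝓘(ℝ, E) x),
    ∀ x, conf x = {b | ∃ t : ℝ, 0 < t ∧ b = t • g.inner x}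
  conn : CovariantDerivative 𝓘(ℝ, E) E (fun x : B => TangentSpace 𝓘(ℝ, E) x)
  smooth_conn : CovariantDerivative.ContMDiffCovariantDerivative conn ∞
  torsion_free : conn.torsion = 0
  conformal : ∀ g : ContMDiffRiemannianMetric 𝓘(ℝ, E) ∞ E (fun x : B => TangentSpace 𝓘(ℝ, E) x),
    (∀ x, g.inner x ∈ conf x) →
    ∃ α : ∀ x : B, TangentSpace 𝓘(ℝ, E) x →L[ℝ] ℝ, ∀ (x : B) (Y Z : ∀ y : B, TangentSpace 𝓘(ℝ, E) y) (X : TangentSpace 𝓘(ℝ, E) x),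
      MDiffAt (T% Y) x → MDiffAt (T% Z) x →
      mvfderiv 𝓘(ℝ, E) (fun y => g.inner y (Y y) (Z y)) x X =
        α x X * g.inner x (Y x) (Z x) + g.inner x (conn Y x X) (Z x)
          + g.inner x (Y x) (conn Z x X)

theorem WeylSpace.isConformalClass (S : WeylSpace E B) (x : B) : IsConformalClass (S.conf x) := by
  obtain ⟨g, hg⟩ := S.exists_metric
  exact ⟨g.inner x, g.symm x, g.pos x, hg x⟩

/-! ### The bundle of isotropic spaces and its almost CR-structure

The bundle of isotropic spaces of a conformal manifold `(B, c)` is regarded as a submanifold of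
`End(TB)`, by identifying an isotropic space `q` on `(T_x B, c)` with the skew-adjoint
`f`-structure whose eigenspace corresponding to `-i` is `q`. -/

/-- The point of `End(TB)` corresponding to an isotropic space at `x`. -/
def isoPoint (c : ∀ x : B, Set (TangentSpace 𝓘(ℝ, E) x →L[ℝ] TangentSpace 𝓘(ℝ, E) x →L[ℝ] ℝ)) (x : B)
    (q : Submodule ℂ (ℂ ⊗[ℝ] TangentSpace 𝓘(ℝ, E) x)) : EndTotal E B :=
  ⟨x, fStructure (c x) q⟩

/-- The horizontal space at `z ∈ End(TB)` of the connection induced by `D`: it is formed of the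
derivatives `dσ(X)` of the sections `σ` of `End(TB)` through `z` with `D_X σ = 0`, where
`(D_X σ) Y = D_X (σ Y) - σ (D_X Y)`. -/
def horizontal (D : CovariantDerivative 𝓘(ℝ, E) E (fun x : B => TangentSpace 𝓘(ℝ, E) x)) (z : EndTotal E B) :
    Submodule ℝ (TangentSpace (endModel E) z) :=
  Submodule.span ℝ {ξ | ∃ (σ : ∀ y : B, TangentSpace 𝓘(ℝ, E) y →L[ℝ] TangentSpace 𝓘(ℝ, E) y) (X : TangentSpace 𝓘(ℝ, E) z.1),
    σ z.1 = z.2 ∧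
    MDifferentiableAt 𝓘(ℝ, E) (endModel E) (fun y => (⟨y, σ y⟩ : EndTotal E B)) z.1 ∧
    (∀ Y : ∀ y : B, TangentSpace 𝓘(ℝ, E) y, MDiffAt (T% Y) z.1 →
      D (fun y => σ y (Y y)) z.1 X = σ z.1 (D Y z.1 X)) ∧
    ξ = mfderiv 𝓘(ℝ, E) (endModel E) (fun y => (⟨y, σ y⟩ : EndTotal E B)) z.1 X}

/-- The tangent vector at `t = 0` of the curve `t ↦ F + t Φ` in the fibre `End(T_x B)`. -/
def vertLift (z : EndTotal E B) (Φ : TangentSpace 𝓘(ℝ, E) z.1 →L[ℝ] TangentSpace 𝓘(ℝ, E) z.1) :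
    TangentSpace (endModel E) z :=
  mfderiv 𝓘(ℝ, ℝ) (endModel E) (fun t : ℝ => (⟨z.1, z.2 + t • Φ⟩ : EndTotal E B)) 0 (1 : ℝ)

end Manifolds

section LinearAlgebra

variable {V : Type*} [AddCommGroup V] [Module ℝ V] [TopologicalSpace V]

/-- The tangent space at `F` of the space of isotropic spaces of a given dimension on `(V, c)`,
viewed as skew-adjoint `f`-structures. The orthogonal group acts transitively on it, by
conjugation, and so its tangent space is formed of the commutators `[A, F]`, with `A`
skew-adjoint. -/
def fibreTangent (c : Set (V →L[ℝ] V →L[ℝ] ℝ)) (F : V →L[ℝ] V) : Set (V →L[ℝ] V) :=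
  {Φ | ∃ A, IsSkew c A ∧ ∀ v, Φ v = A (F v) - F (A v)}

/-- `δ ∈ Hom(q, (ℂ ⊗ V) / q)` is the derivative, in the direction `Φ`, of the map
`F ↦ q = ker (F + i)` with values in the Grassmannian of `ℂ ⊗ V`. (If `v(t)` is a curve with
`(F(t) + i) v(t) = 0` then the derivative maps `v(0)` to the class of `w = v'(0)`, and
`(F + i) w = - Φ v`.) -/
def IsPlaneVelocity (F Φ : V →L[ℝ] V)
    (δ : minusI F →ₗ[ℂ] (ℂ ⊗[ℝ] V) ⧸ minusI F) : Prop :=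
  ∀ (v : minusI F) (w : ℂ ⊗[ℝ] V), (minusI F).mkQ w = δ v →
    cx F w + Complex.I • w = - cx Φ v

/-- `Ψ = 𝒥 Φ`, where `𝒥` is the complex structure on the tangent space at `F` of the space of
isotropic spaces, induced from the Grassmannian of `ℂ ⊗ V`. -/
def IsTimesI (F Φ Ψ : V →L[ℝ] V) : Prop :=
  ∃ δ, IsPlaneVelocity F Φ δ ∧ IsPlaneVelocity F Ψ (Complex.I • δ)

end LinearAlgebra

section Manifolds

variable {E : Type*} [NormedAddCommGroup E] [NormedSpace ℝ E] [FiniteDimensional ℝ E]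
  {B : Type*} [TopologicalSpace B] [ChartedSpace E B] [IsManifold 𝓘(ℝ, E) ∞ B]

/-- The space `(ker dπ)^{1,0}` at a point of the bundle of isotropic spaces: it is spanned by the
vectors `ξ - i 𝒥 ξ`, with `ξ` tangent to the fibre. -/
def vert10 (c : ∀ x : B, Set (TangentSpace 𝓘(ℝ, E) x →L[ℝ] TangentSpace 𝓘(ℝ, E) x →L[ℝ] ℝ)) (z : EndTotal E B) :
    Submodule ℂ (ℂ ⊗[ℝ] TangentSpace (endModel E) z) :=
  Submodule.span ℂ {ζ | ∃ Φ ∈ fibreTangent (c z.1) z.2, ∃ Ψ ∈ fibreTangent (c z.1) z.2,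
    IsTimesI z.2 Φ Ψ ∧
    ζ = (1 : ℂ) ⊗ₜ[ℝ] vertLift z Φ - Complex.I ⊗ₜ[ℝ] vertLift z Ψ}

/-- The space `𝒢₀` of complexified horizontal vectors at `z` which are projected, by `dπ`, to the
isotropic space `q = ker (F + i)` corresponding to `z`. -/
def horizG0 (D : CovariantDerivative 𝓘(ℝ, E) E (fun x : B => TangentSpace 𝓘(ℝ, E) x)) (z : EndTotal E B) :
    Submodule ℂ (ℂ ⊗[ℝ] TangentSpace (endModel E) z) :=
  (horizontal D z).baseChange ℂ ⊓
    (minusI z.2).comap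
      (cx (mfderiv (endModel E) 𝓘(ℝ, E) (fun w : EndTotal E B => w.1) z))

/-- The complex distribution `𝒢' = 𝒢₀ ⊕ (ker dπ)^{1,0}` on the bundle of isotropic spaces, that
is, the eigenbundle corresponding to `-i` of the almost CR-structure `𝒥'`. -/
def distG' (c : ∀ x : B, Set (TangentSpace 𝓘(ℝ, E) x →L[ℝ] TangentSpace 𝓘(ℝ, E) x →L[ℝ] ℝ))
    (D : CovariantDerivative 𝓘(ℝ, E) E (fun x : B => TangentSpace 𝓘(ℝ, E) x)) (z : EndTotal E B) :
    Submodule ℂ (ℂ ⊗[ℝ] TangentSpace (endModel E) z) :=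
  horizG0 D z ⊔ vert10 c z

/-- A map `f` from a manifold endowed with an almost complex structure `J` to a manifold endowed
with an almost CR-structure, whose associated complex distribution (the eigenbundle corresponding
to `-i`) is `𝒢`, is holomorphic if `df` maps the eigenbundle of `J` corresponding to `-i`
into `𝒢`. -/
def IsHolomorphic {E' H' P : Type*} [NormedAddCommGroup E'] [NormedSpace ℝ E']
    [TopologicalSpace H'] (I' : ModelWithCorners ℝ E' H') [TopologicalSpace P]
    [ChartedSpace H' P] (J : ∀ x : B, TangentSpace 𝓘(ℝ, E) x →L[ℝ] TangentSpace 𝓘(ℝ, E) x) (f : B → P)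
    (𝒢 : ∀ z : P, Submodule ℂ (ℂ ⊗[ℝ] TangentSpace I' z)) : Prop :=
  ∀ x, (minusI (J x)).map (cx (mfderiv 𝓘(ℝ, E) I' f x)) ≤ 𝒢 (f x)

variable (E) in
/-- A field of orientations of the tangent spaces which is locally constant, that is, an
orientation of the manifold. -/
def IsOrientation {k : ℕ} (o : ∀ x : B, Orientation ℝ (TangentSpace 𝓘(ℝ, E) x) (Fin k)) : Prop :=
  ∀ (x : B) (b : Module.Basis (Fin k) ℝ (TangentSpace 𝓘(ℝ, E) x)), b.orientation = o x →
    ∀ᶠ y in 𝓝 x, ∀ b' : Module.Basis (Fin k) ℝ (TangentSpace 𝓘(ℝ, E) y),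
      (∀ i, b' i = extend E (b i) y) → b'.orientation = o y

end Manifolds

/-- A complex structure `J` on an oriented vector space is positive if the bases of the form
`(e₁, J e₁, …, e_r, J e_r)` are positive. -/
def IsPositive {V : Type*} [AddCommGroup V] [Module ℝ V] {r : ℕ}
    (o : Orientation ℝ V (Fin (2 * r))) (J : V → V) : Prop :=
  ∀ b : Module.Basis (Fin (2 * r)) ℝ V,
    (∀ k : Fin r, b ⟨2 * k + 1, by omega⟩ = J (b ⟨2 * k, by omega⟩)) → b.orientation = o

section Submanifolds

variable {E : Type*} [NormedAddCommGroup E] [NormedSpace ℝ E] [FiniteDimensional ℝ E]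
  {N : Type*} [TopologicalSpace N] [ChartedSpace E N] [IsManifold 𝓘(ℝ, E) ∞ N]
  {E' : Type*} [NormedAddCommGroup E'] [NormedSpace ℝ E'] [FiniteDimensional ℝ E']
  {M : Type*} [TopologicalSpace M] [ChartedSpace E' M] [IsManifold 𝓘(ℝ, E') ∞ M]

/-- The differential of a map `ι : M → N`. -/
abbrev dif (E E' : Type*) [NormedAddCommGroup E] [NormedSpace ℝ E] [NormedAddCommGroup E']
    [NormedSpace ℝ E'] {N M : Type*} [TopologicalSpace N] [ChartedSpace E N]
    [TopologicalSpace M] [ChartedSpace E' M] (ι : M → N) (x : M) : TangentSpace 𝓘(ℝ, E') x →L[ℝ] TangentSpace 𝓘(ℝ, E) (ι x) :=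
  mfderiv 𝓘(ℝ, E') 𝓘(ℝ, E) ι x

variable (E E') in
/-- `ι` is the inclusion of a submanifold (that is, an injective immersion). -/
structure IsSubmanifold (ι : M → N) : Prop where
  smooth : ContMDiff 𝓘(ℝ, E') 𝓘(ℝ, E) ∞ ι
  injective : Function.Injective ι
  immersive : ∀ x, Function.Injective (dif E E' ι x)

/-- The conformal structure `c|_M`. -/
def inducedConf (c : ∀ x : N, Set (TangentSpace 𝓘(ℝ, E) x →L[ℝ] TangentSpace 𝓘(ℝ, E) x →L[ℝ] ℝ)) (ι : M → N) (x : M) :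
    Set (TangentSpace 𝓘(ℝ, E') x →L[ℝ] TangentSpace 𝓘(ℝ, E') x →L[ℝ] ℝ) :=
  {b' | ∃ b ∈ c (ι x), ∀ v w, b' v w = b (dif E E' ι x v) (dif E E' ι x w)}

theorem exists_tangentialPart (S : WeylSpace E N) {ι : M → N} (hι : IsSubmanifold E E' ι)
    (x : M) : ∃ P : TangentSpace 𝓘(ℝ, E) (ι x) →L[ℝ] TangentSpace 𝓘(ℝ, E') x, (∀ u, P (dif E E' ι x u) = u) ∧
      ∀ b ∈ S.conf (ι x), ∀ w u, b (w - dif E E' ι x (P w)) (dif E E' ι x u) = 0 := by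
  obtain ⟨g, hs, hp, hc⟩ := S.isConformalClass (ι x)
  obtain ⟨P, h1, h2⟩ := exists_orthogonal_projection g hs hp (dif E E' ι x).toLinearMap
    (hι.immersive x)
  refine ⟨LinearMap.toContinuousLinearMap P, h1, ?_⟩
  rw [hc]
  rintro b ⟨t, ht, rfl⟩ w u
  have := h2 w u
  simp only [smul_apply, smul_eq_mul]
  exact mul_eq_zero_of_right _ this

/-- The tangential part `TN|_M → TM`, with respect to the conformal structure. -/
def tangentialPart (S : WeylSpace E N) {ι : M → N} (hι : IsSubmanifold E E' ι) (x : M) :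
    TangentSpace 𝓘(ℝ, E) (ι x) →L[ℝ] TangentSpace 𝓘(ℝ, E') x :=
  (exists_tangentialPart S hι x).choose

/-- The pull back, to the bundle `ι^*(TN)`, of a connection on `N`: in the local trivialization
of `TN` at `ι x`, if `V = ∑ Vⁱ eᵢ`, with `{eᵢ}` the corresponding local frame of `TN`, then
`D_X V = ∑ X(Vⁱ) eᵢ + Vⁱ(x) D_{dι(X)} eᵢ`. -/
def pullbackDeriv (D : CovariantDerivative 𝓘(ℝ, E) E (fun x : N => TangentSpace 𝓘(ℝ, E) x)) (ι : M → N)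
    (V : ∀ x : M, TangentSpace 𝓘(ℝ, E) (ι x)) (x : M) : TangentSpace 𝓘(ℝ, E') x →L[ℝ] TangentSpace 𝓘(ℝ, E) (ι x) :=
  let e := trivializationAt E (fun y : N => TangentSpace 𝓘(ℝ, E) y) (ι x)
  (e.symmL ℝ (ι x)) ∘L
      mvfderiv 𝓘(ℝ, E') (fun y => (e ⟨ι y, V y⟩).2) x +
    D (extend E (V x)) (ι x) ∘L dif E E' ι x


theorem extend_eq {x : N} (u : TangentSpace 𝓘(ℝ, E) x) {y : N}
    (hy : y ∈ (trivializationAt E (TangentSpace 𝓘(ℝ, E) : N → Type _) x).baseSet) :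
    extend E u y =
      (trivializationAt E (TangentSpace 𝓘(ℝ, E) : N → Type _) x).symmL ℝ y
        ((trivializationAt E (TangentSpace 𝓘(ℝ, E) : N → Type _) x).continuousLinearMapAt ℝ x
          u) := by
  have h : (trivializationAt E (TangentSpace 𝓘(ℝ, E) : N → Type _) x).continuousLinearMapAt ℝ x
      u = (trivializationAt E (TangentSpace 𝓘(ℝ, E) : N → Type _) x ⟨x, u⟩).2 := by
    rw [Trivialization.continuousLinearMapAt_apply, Trivialization.linearMapAt_apply,
      if_pos (FiberBundle.mem_baseSet_trivializationAt' x)]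
  rw [h, Trivialization.symmL_apply _ hy, extend]

theorem conn_extend_add (D : CovariantDerivative 𝓘(ℝ, E) E (fun x : N => TangentSpace 𝓘(ℝ, E) x))
    {x : N} (v w : TangentSpace 𝓘(ℝ, E) x) :
    D (extend E (v + w)) x = D (extend E v) x + D (extend E w) x := by
  have hv := mdifferentiableAt_extend 𝓘(ℝ, E) E v
  have hw := mdifferentiableAt_extend 𝓘(ℝ, E) E w
  rw [← D.isCovariantDerivativeOnUniv.add hv hw]
  refine D.isCovariantDerivativeOnUniv.congr_of_eventuallyEq (mdifferentiableAt_extend ..)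
    (mdifferentiableAt_add_section hv hw) Filter.univ_mem ?_
  filter_upwards [(trivializationAt E (TangentSpace 𝓘(ℝ, E) : N → Type _) x).open_baseSet.mem_nhds
    (FiberBundle.mem_baseSet_trivializationAt' x)] with y hy
  simp only [Pi.add_apply, extend_eq _ hy, map_add]

theorem conn_extend_smul
    (D : CovariantDerivative 𝓘(ℝ, E) E (fun x : N => TangentSpace 𝓘(ℝ, E) x))
    {x : N} (a : ℝ) (v : TangentSpace 𝓘(ℝ, E) x) :
    D (extend E (a • v)) x = a • D (extend E v) x := by
  have hv := mdifferentiableAt_extend 𝓘(ℝ, E) E v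
  rw [← D.isCovariantDerivativeOnUniv.smul_const a hv]
  refine D.isCovariantDerivativeOnUniv.congr_of_eventuallyEq (mdifferentiableAt_extend ..)
    (MDifferentiableAt.smul_section mdifferentiableAt_const hv) Filter.univ_mem ?_
  filter_upwards [(trivializationAt E (TangentSpace 𝓘(ℝ, E) : N → Type _) x).open_baseSet.mem_nhds
    (FiberBundle.mem_baseSet_trivializationAt' x)] with y hy
  simp only [Pi.smul_apply, extend_eq _ hy, map_smul]

section PullBack

variable {ι : M → N} {x : M}

theorem mdifferentiableAt_dif (hι : IsSubmanifold E E' ι)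
    {Y : ∀ x : M, TangentSpace 𝓘(ℝ, E') x} (hY : MDiffAt (T% Y) x) :
    MDifferentiableAt 𝓘(ℝ, E') (𝓘(ℝ, E).prod 𝓘(ℝ, E))
      (fun y => (⟨ι y, dif E E' ι y (Y y)⟩ : TangentBundle 𝓘(ℝ, E) N)) x := by
  have h1 : ContMDiff 𝓘(ℝ, E').tangent 𝓘(ℝ, E).tangent 1 (tangentMap 𝓘(ℝ, E') 𝓘(ℝ, E) ι) :=
    hι.smooth.contMDiff_tangentMap (by norm_cast)
  exact (h1.mdifferentiable one_ne_zero).mdifferentiableAt.comp x hY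

theorem mdifferentiableAt_coord (hι : IsSubmanifold E E' ι)
    {Y : ∀ x : M, TangentSpace 𝓘(ℝ, E') x} (hY : MDiffAt (T% Y) x) :
    MDifferentiableAt 𝓘(ℝ, E') 𝓘(ℝ, E)
      (fun y => (trivializationAt E (fun y : N => TangentSpace 𝓘(ℝ, E) y) (ι x)
        ⟨ι y, dif E E' ι y (Y y)⟩).2) x := by
  have h := mdifferentiableAt_dif hι hY
  rw [mdifferentiableAt_totalSpace] at h
  exact h.2

theorem eventually_baseSet (hι : IsSubmanifold E E' ι) (x : M) :
    ∀ᶠ y in 𝓝 x, ι y ∈ (trivializationAt E (fun y : N => TangentSpace 𝓘(ℝ, E) y)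
      (ι x)).baseSet :=
  hι.smooth.continuous.continuousAt.eventually
    ((trivializationAt E (fun y : N => TangentSpace 𝓘(ℝ, E) y) (ι x)).open_baseSet.mem_nhds
      (FiberBundle.mem_baseSet_trivializationAt' (ι x)))

theorem mvfderiv_congr {f g : M → E} (h : f =ᶠ[𝓝 x] g) :
    mvfderiv 𝓘(ℝ, E') f x = mvfderiv 𝓘(ℝ, E') g x := by
  ext X
  exact congrArg (fun L : TangentSpace 𝓘(ℝ, E') x →L[ℝ] E => L X) h.mfderiv_eq

theorem pullbackDeriv_add (hι : IsSubmanifold E E' ι)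
    (D : CovariantDerivative 𝓘(ℝ, E) E (fun x : N => TangentSpace 𝓘(ℝ, E) x))
    {Y Z : ∀ x : M, TangentSpace 𝓘(ℝ, E') x}
    (hY : MDiffAt (T% Y) x) (hZ : MDiffAt (T% Z) x) :
    (pullbackDeriv D ι (fun y => dif E E' ι y ((Y + Z) y)) x :
      TangentSpace 𝓘(ℝ, E') x →L[ℝ] TangentSpace 𝓘(ℝ, E) (ι x)) =
      pullbackDeriv D ι (fun y => dif E E' ι y (Y y)) x +
        pullbackDeriv D ι (fun y => dif E E' ι y (Z y)) x := by
  have h1 := mdifferentiableAt_coord hι hY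
  have h2 := mdifferentiableAt_coord hι hZ
  simp only [pullbackDeriv]
  have h3 : (fun y => (trivializationAt E (fun y : N => TangentSpace 𝓘(ℝ, E) y) (ι x)
        ⟨ι y, dif E E' ι y ((Y + Z) y)⟩).2) =ᶠ[𝓝 x]
      (fun y => (trivializationAt E (fun y : N => TangentSpace 𝓘(ℝ, E) y) (ι x)
        ⟨ι y, dif E E' ι y (Y y)⟩).2) + fun y => (trivializationAt E (fun y : N => TangentSpace 𝓘(ℝ, E) y) (ι x)
        ⟨ι y, dif E E' ι y (Z y)⟩).2 := by
    filter_upwards [eventually_baseSet hι x] with y hy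
    simp only [Pi.add_apply, map_add]
    exact ((trivializationAt E (fun y : N => TangentSpace 𝓘(ℝ, E) y) (ι x)).linear ℝ hy).map_add _ _
  have h4 : D (extend E (dif E E' ι x ((Y + Z) x))) (ι x) =
      D (extend E (dif E E' ι x (Y x))) (ι x) + D (extend E (dif E E' ι x (Z x))) (ι x) := by
    rw [Pi.add_apply, map_add, conn_extend_add]
  rw [mvfderiv_congr h3, mvfderiv_add h1 h2, h4]
  ext X
  simp only [add_apply, ContinuousLinearMap.comp_apply, map_add]
  abel

theorem pullbackDeriv_smul (hι : IsSubmanifold E E' ι)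
    (D : CovariantDerivative 𝓘(ℝ, E) E (fun x : N => TangentSpace 𝓘(ℝ, E) x))
    {f : M → ℝ} {Y : ∀ x : M, TangentSpace 𝓘(ℝ, E') x}
    (hY : MDiffAt (T% Y) x) (hf : MDiffAt f x) :
    (pullbackDeriv D ι (fun y => dif E E' ι y ((f • Y) y)) x :
      TangentSpace 𝓘(ℝ, E') x →L[ℝ] TangentSpace 𝓘(ℝ, E) (ι x)) =
      f x • pullbackDeriv D ι (fun y => dif E E' ι y (Y y)) x +
        (d% f x).smulRight (dif E E' ι x (Y x)) := by
  have h1 := mdifferentiableAt_coord hι hY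
  simp only [pullbackDeriv]
  have hx : ι x ∈ (trivializationAt E (fun y : N => TangentSpace 𝓘(ℝ, E) y) (ι x)).baseSet :=
    FiberBundle.mem_baseSet_trivializationAt' (ι x)
  have h3 : (fun y => (trivializationAt E (fun y : N => TangentSpace 𝓘(ℝ, E) y) (ι x)
        ⟨ι y, dif E E' ι y ((f • Y) y)⟩).2) =ᶠ[𝓝 x]
      f • fun y => (trivializationAt E (fun y : N => TangentSpace 𝓘(ℝ, E) y) (ι x)
        ⟨ι y, dif E E' ι y (Y y)⟩).2 := by
    filter_upwards [eventually_baseSet hι x] with y hy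
    rw [Pi.smul_apply', Pi.smul_apply', map_smul]
    exact ((trivializationAt E (fun y : N => TangentSpace 𝓘(ℝ, E) y) (ι x)).linear ℝ hy).map_smul _ _
  have h4 : D (extend E (dif E E' ι x ((f • Y) x))) (ι x) =
      f x • D (extend E (dif E E' ι x (Y x))) (ι x) := by
    rw [Pi.smul_apply', map_smul, conn_extend_smul]
  have h5 : (trivializationAt E (fun y : N => TangentSpace 𝓘(ℝ, E) y) (ι x)).symmL ℝ (ι x) (trivializationAt E (fun y : N => TangentSpace 𝓘(ℝ, E) y) (ι x)
        ⟨ι x, dif E E' ι x (Y x)⟩).2 = dif E E' ι x (Y x) := by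
    rw [Trivialization.symmL_apply _ hx]
    exact (trivializationAt E (fun y : N => TangentSpace 𝓘(ℝ, E) y) (ι x)).symm_apply_apply_mk hx _
  rw [mvfderiv_congr h3, mvfderiv_smul hf h1, h4]
  ext X
  simp only [add_apply, smul_apply, ContinuousLinearMap.comp_apply, map_add, map_smul,
    ContinuousLinearMap.smulRight_apply, h5, smul_add]
  abel

/-- The connection `D^M` induced by `D^N` on a submanifold: `D^M_X Y` is the tangential part of
`D^N_X Y`. -/
def inducedConn (S : WeylSpace E N) (hι : IsSubmanifold E E' ι) :
    CovariantDerivative 𝓘(ℝ, E') E' (fun x : M => TangentSpace 𝓘(ℝ, E') x) where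
  toFun Y x := tangentialPart S hι x ∘L pullbackDeriv S.conn ι (fun y => dif E E' ι y (Y y)) x
  isCovariantDerivativeOnUniv := by
    refine ⟨fun {Y Z x} hY hZ _ => ?_, fun {Y f x} hY hf _ => ?_⟩
    · rw [pullbackDeriv_add hι S.conn hY hZ, ContinuousLinearMap.comp_add]
    · rw [pullbackDeriv_smul hι S.conn hY hf]
      ext X
      have h : tangentialPart S hι x (dif E E' ι x (Y x)) = Y x :=
        (exists_tangentialPart S hι x).choose_spec.1 (Y x)
      simp only [add_apply, smul_apply, ContinuousLinearMap.comp_apply, map_add, map_smul,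
        ContinuousLinearMap.smulRight_apply, h]

end PullBack

/-- The second fundamental form `D dι` of a submanifold, with respect to the connections `D^N`
and `D^M`: `(D dι)(X, Y) = D^N_X (dι Y) - dι (D^M_X Y)`, where `Y` is extended to a vector
field. -/
def secondFundamentalForm (S : WeylSpace E N) {ι : M → N} (hι : IsSubmanifold E E' ι) (x : M)
    (X Y : TangentSpace 𝓘(ℝ, E') x) : TangentSpace 𝓘(ℝ, E) (ι x) :=
  pullbackDeriv S.conn ι (fun y => dif E E' ι y (extend E' Y y)) x X -
    dif E E' ι x (inducedConn S hι (extend E' Y) x X)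

/-- `(M, J)` is a `(1,1)`-geodesic submanifold: the `(1,1)`-part
`(X, Y) ↦ (b(X, Y) + b(J X, J Y)) / 2` of the second fundamental form `b = D dι` is zero. -/
def IsOneOneGeodesic (S : WeylSpace E N) {ι : M → N} (hι : IsSubmanifold E E' ι)
    (J : ∀ x : M, TangentSpace 𝓘(ℝ, E') x →L[ℝ] TangentSpace 𝓘(ℝ, E') x) : Prop :=
  ∀ (x : M) (X Y : TangentSpace 𝓘(ℝ, E') x),
    (2⁻¹ : ℝ) • (secondFundamentalForm S hι x X Y +
      secondFundamentalForm S hι x (J x X) (J x Y)) = 0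

/-- `p` is a (smooth) section over the submanifold `M` of the bundle `Q_{N,r}` of isotropic spaces
on `N`, of complex dimension `r`. -/
structure IsIsotropicSection (S : WeylSpace E N) (E' : Type*) [NormedAddCommGroup E']
    [NormedSpace ℝ E'] {M : Type*} [TopologicalSpace M] [ChartedSpace E' M] (ι : M → N) (r : ℕ)
    (p : ∀ x : M, Submodule ℂ (ℂ ⊗[ℝ] TangentSpace 𝓘(ℝ, E) (ι x))) : Prop where
  isotropic : ∀ x, IsIsotropic (S.conf (ι x)) (p x)
  finrank : ∀ x, Module.finrank ℂ (p x) = r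
  smooth : ContMDiff 𝓘(ℝ, E') (endModel E) ∞ (fun x => isoPoint S.conf (ι x) (p x))

variable (E') in
/-- For `p x` tangent to `M`, the corresponding subspace of the complexified tangent space
of `M`. -/
def tangentPlane {ι : M → N} (p : ∀ x : M, Submodule ℂ (ℂ ⊗[ℝ] TangentSpace 𝓘(ℝ, E) (ι x)))
    (x : M) : Submodule ℂ (ℂ ⊗[ℝ] TangentSpace 𝓘(ℝ, E') x) :=
  (p x).comap (cx (dif E E' ι x))

variable (E') in
/-- The almost Hermitian structure `J^p` on `(M, c|_M)` whose eigenbundle corresponding to `-i`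
is `p`. -/
def almostHermitian (S : WeylSpace E N) {ι : M → N}
    (p : ∀ x : M, Submodule ℂ (ℂ ⊗[ℝ] TangentSpace 𝓘(ℝ, E) (ι x))) (x : M) :
    TangentSpace 𝓘(ℝ, E') x →L[ℝ] TangentSpace 𝓘(ℝ, E') x :=
  fStructure (inducedConf S.conf ι x) (tangentPlane E' p x)

end Submanifolds

end WeylTwistor

end

/-
The section `p` corresponds to the field `F` of skew `f`-structures with eigenbundle `p` for `-i`;
as `p` is tangent to `M`, `F = dι ∘ J ∘ P`, where `J = J^p` and `P` is the tangential projection.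
A vector is in the eigenbundle of `𝒥'` exactly when its projection `Z` on the base is in `p` and
its vertical part, which for `dF(Z)` is `D_Z F`, vanishes on the conjugate of `p`. Hence `p` is
holomorphic if and only if `(D_X F)(Y) + (D_{JX} F)(JY) = 0` for all `X`, `Y` in `TM`, and likewise
for `(M, D^M, J)`.
The Gauss formula `(D_X F)(Y) = (D^M_X J)(Y) + b(X, JY)` splits this equation into its tangential
part, which is the holomorphy of `p` as a section of `Q_M`, and the normal part
`b(X, JY) + b(JX, JJY) = 0`, which, `J` being surjective, is the `(1,1)`-geodesic condition.
-/

noncomputable section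

namespace WeylTwistor

/-! ### Complexified vectors and `f`-structures -/

section Complexification

variable {U V W : Type*} [AddCommGroup U] [Module ℝ U] [TopologicalSpace U]
  [AddCommGroup V] [Module ℝ V] [TopologicalSpace V]

theorem cx_comp_apply [AddCommGroup W] [Module ℝ W] [TopologicalSpace W]
    (f : V →L[ℝ] W) (g : U →L[ℝ] V) (z : ℂ ⊗[ℝ] U) : cx (f ∘L g) z = cx f (cx g z) :=
  ext_reV_imV (by simp only [reV_cx, ContinuousLinearMap.comp_apply])
    (by simp only [imV_cx, ContinuousLinearMap.comp_apply])

theorem cx_injective {f : U →L[ℝ] V} (hf : Function.Injective f) :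
    Function.Injective (cx f) := fun u v huv =>
  ext_reV_imV (hf (by rw [← reV_cx, ← reV_cx, huv])) (hf (by rw [← imV_cx, ← imV_cx, huv]))

theorem reV_smul (a : ℂ) (z : ℂ ⊗[ℝ] V) : reV (a • z) = a.re • reV z - a.im • imV z := by
  induction z with
  | zero => simp
  | tmul b v => simp [TensorProduct.smul_tmul', sub_smul, mul_smul]
  | add x y hx hy => simp only [smul_add, map_add, hx, hy]; abel

theorem imV_smul (a : ℂ) (z : ℂ ⊗[ℝ] V) : imV (a • z) = a.re • imV z + a.im • reV z := by
  induction z with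
  | zero => simp
  | tmul b v => simp [TensorProduct.smul_tmul', add_smul, mul_smul]
  | add x y hx hy => simp only [smul_add, map_add, hx, hy]; abel

theorem mem_baseChange_complex_iff {H : Submodule ℝ V} {z : ℂ ⊗[ℝ] V} :
    z ∈ H.baseChange ℂ ↔ reV z ∈ H ∧ imV z ∈ H := by
  constructor
  · intro h
    rw [Submodule.baseChange_eq_span] at h
    induction h using Submodule.span_induction with
    | mem _ h =>
      obtain ⟨v, hv, rfl⟩ := h
      simpa using hv
    | zero => simp
    | add x y _ _ hx hy =>
      simp only [map_add]
      exact ⟨H.add_mem hx.1 hy.1, H.add_mem hx.2 hy.2⟩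
    | smul a x _ hx =>
      rw [reV_smul, imV_smul]
      exact ⟨H.sub_mem (H.smul_mem _ hx.1) (H.smul_mem _ hx.2),
        H.add_mem (H.smul_mem _ hx.2) (H.smul_mem _ hx.1)⟩
  · rintro ⟨hre, him⟩
    rw [← reV_add_imV z]
    exact add_mem (Submodule.tmul_mem_baseChange_of_mem _ hre)
      (Submodule.tmul_mem_baseChange_of_mem _ him)

theorem cx_apply_of_mem_minusI {J : V →L[ℝ] V} {z : ℂ ⊗[ℝ] V} (hz : z ∈ minusI J) :
    cx J z = -Complex.I • z :=
  Module.End.mem_eigenspace_iff.1 hz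

theorem minusI_conj {L : U →L[ℝ] V} {P : V →L[ℝ] U} (hPL : ∀ u, P (L u) = u) (J : U →L[ℝ] U) :
    minusI (L ∘L J ∘L P) = (minusI J).map (cx L) := by
  have hPL' : ∀ u, cx P (cx L u) = u := fun u =>
    ext_reV_imV (by rw [reV_cx, reV_cx, hPL]) (by rw [imV_cx, imV_cx, hPL])
  ext z
  rw [Submodule.mem_map, minusI, Module.End.mem_eigenspace_iff, cx_comp_apply, cx_comp_apply]
  constructor
  · intro hz
    have hPz : cx J (cx P z) = -Complex.I • cx P z := by
      rw [← map_smul, ← hz, hPL']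
    refine ⟨cx P z, Module.End.mem_eigenspace_iff.2 hPz, ?_⟩
    rw [hPz, map_smul] at hz
    exact smul_right_injective _ (neg_ne_zero.2 Complex.I_ne_zero) hz
  · rintro ⟨u, hu, rfl⟩
    rw [hPL', cx_apply_of_mem_minusI hu, map_smul]

theorem apply_apply_of_finrank_minusI [FiniteDimensional ℝ V] {J : V →L[ℝ] V}
    (h : Module.finrank ℝ V = 2 * Module.finrank ℂ (minusI J)) (v : V) : J (J v) = -v := by
  let ρ : minusI J →ₗ[ℝ] V := reV ∘ₗ ((minusI J).restrictScalars ℝ).subtype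
  have hρ : Function.Injective ρ := by
    rw [injective_iff_map_eq_zero]
    rintro ⟨z, hz⟩ (hre : reV z = 0)
    have him : imV z = 0 := by rw [← (mem_minusI.1 hz).1, hre, map_zero]
    exact Subtype.ext (ext_reV_imV (by simpa using hre) (by simpa using him))
  have hfr : Module.finrank ℝ (minusI J) = Module.finrank ℝ V := by
    rw [← Module.finrank_mul_finrank ℝ ℂ (minusI J), Complex.finrank_real_complex, h]
  have : FiniteDimensional ℝ (minusI J) :=
    inferInstanceAs (FiniteDimensional ℝ ((minusI J).restrictScalars ℝ))
  obtain ⟨⟨z, hz⟩, rfl⟩ :=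
    (LinearMap.injective_iff_surjective_of_finrank_eq_finrank hfr).1 hρ v
  change J (J (reV z)) = -reV z
  rw [(mem_minusI.1 hz).1, (mem_minusI.1 hz).2]

theorem tmul_add_mem_minusI {J : V →L[ℝ] V} (hJ : ∀ v, J (J v) = -v) (v : V) :
    (1 : ℂ) ⊗ₜ[ℝ] v + Complex.I ⊗ₜ[ℝ] J v ∈ minusI J := by
  simp [mem_minusI, hJ]

theorem forall_minusI_iff [AddCommGroup W] {J : V →L[ℝ] V} (hJ : ∀ v, J (J v) = -v)
    (Q : V → V → W) :
    (∀ Z ∈ minusI J, ∀ v ∈ minusI J, Q (reV Z) (reV v) + Q (imV Z) (imV v) = 0) ↔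
      ∀ X Y, Q X Y + Q (J X) (J Y) = 0 := by
  constructor
  · intro h X Y
    simpa using h _ (tmul_add_mem_minusI hJ X) _ (tmul_add_mem_minusI hJ Y)
  · intro h Z hZ v hv
    rw [← (mem_minusI.1 hZ).1, ← (mem_minusI.1 hv).1]
    exact h _ _

theorem isFStructureOf_conj {c : Set (V →L[ℝ] V →L[ℝ] ℝ)} {c' : Set (U →L[ℝ] U →L[ℝ] ℝ)}
    {L : U →L[ℝ] V} {P : V →L[ℝ] U} (hPL : ∀ u, P (L u) = u)
    (hadj : ∀ b ∈ c, ∃ b' ∈ c', (∀ u v, b (L u) v = b' u (P v)) ∧ ∀ v u, b v (L u) = b' (P v) u)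
    {q : Submodule ℂ (ℂ ⊗[ℝ] U)} {J : U →L[ℝ] U} (hJ : IsFStructureOf c' q J) :
    IsFStructureOf c (q.map (cx L)) (L ∘L J ∘L P) := by
  obtain ⟨hskew, hcube, rfl⟩ := hJ
  refine ⟨fun b hb v w => ?_, fun v => ?_, minusI_conj hPL J⟩
  · obtain ⟨b', hb', hleft, hright⟩ := hadj b hb
    simp only [ContinuousLinearMap.comp_apply, hleft, hright]
    exact hskew b' hb' _ _
  · simp only [ContinuousLinearMap.comp_apply, hPL]
    rw [← map_add, hcube, map_zero]

end Complexification

section FibreTangent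

variable {V : Type*} [AddCommGroup V] [Module ℝ V] [TopologicalSpace V]
  {c : Set (V →L[ℝ] V →L[ℝ] ℝ)} {F Φ Ψ : V →L[ℝ] V}

theorem IsSkew.apply_left (hF : IsSkew c F) {b : V →L[ℝ] V →L[ℝ] ℝ} (hb : b ∈ c) (v w : V) :
    b (F v) w = -b v (F w) :=
  eq_neg_of_add_eq_zero_left (hF b hb v w)

theorem neg_mem_fibreTangent [IsTopologicalAddGroup V] (h : Φ ∈ fibreTangent c F) :
    -Φ ∈ fibreTangent c F := by
  obtain ⟨A, hA, hΦ⟩ := h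
  refine ⟨-A, fun b hb v w => ?_, fun v => ?_⟩
  · simp only [neg_apply, map_neg, hA.apply_left hb, neg_neg, add_neg_cancel]
  · simp only [neg_apply, map_neg, hΦ v]
    abel

theorem apply_sq_of_linearized_cube (hF : ∀ v, F (F (F v)) = -F v)
    (hΦ : ∀ v, F (F (Φ v)) + F (Φ (F v)) + Φ (F (F v)) + Φ v = 0) (v : V) :
    F (F (Φ (F (F v)))) = F (Φ (F v)) := by
  have h := congrArg F (hΦ (F v))
  simp only [map_add, hF, map_neg, map_zero] at h
  rw [← sub_eq_zero, ← h]
  abel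

/- In the eigenspaces of `F`, for the eigenvalues `0` and `±i`, the linearization of `F³ + F = 0`
says that the diagonal blocks of `Φ` vanish, while the block of `[A, F]` from the `a`-eigenspace
to the `b`-eigenspace is `(a - b)` times that of `A`. The commutator `[F, Φ]` divides by `a - b`
where `a - b = ± i`, and the last term of `A` corrects it where `a - b = ± 2i`. -/
theorem mem_fibreTangent_of_isSkew [IsTopologicalAddGroup V] [ContinuousSMul ℝ V]
    (hF : IsSkew c F) (hΦ : IsSkew c Φ) (hF3 : ∀ v, F (F (F v)) + F v = 0)
    (hlin : ∀ v, F (F (Φ v)) + F (Φ (F v)) + Φ (F (F v)) + Φ v = 0) : Φ ∈ fibreTangent c F := by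
  have hF3' : ∀ v, F (F (F v)) = -F v := fun v => eq_neg_of_add_eq_zero_left (hF3 v)
  have hsq := apply_sq_of_linearized_cube hF3' hlin
  have hsq' : ∀ v, F (F (Φ (F v))) = -F (Φ (F (F v))) := fun v => by
    rw [← hF3', hsq]
  refine ⟨F ∘L Φ - Φ ∘L F - (3 / 2 : ℝ) • (F ∘L F ∘L Φ ∘L F), fun b hb v w => ?_, fun v => ?_⟩
  · simp only [sub_apply, smul_apply, ContinuousLinearMap.comp_apply, map_sub, map_smul,
      smul_eq_mul, hF.apply_left hb, hΦ.apply_left hb, hsq' w, map_neg]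
    ring
  · simp only [sub_apply, smul_apply, ContinuousLinearMap.comp_apply, map_sub, map_smul, hsq, hF3']
    have hΦv : Φ v = -F (F (Φ v)) - F (Φ (F v)) - Φ (F (F v)) := by
      rw [← sub_eq_zero, ← hlin v]; abel
    refine hΦv.trans ?_
    module

theorem IsTimesI.apply_reV (h : IsTimesI F Φ Ψ) {v : ℂ ⊗[ℝ] V} (hv : v ∈ minusI F) :
    Φ (reV v) = Ψ (imV v) := by
  obtain ⟨δ, hδ, hIδ⟩ := h
  obtain ⟨w, hw⟩ := (minusI F).mkQ_surjective (δ ⟨v, hv⟩)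
  have hIw := hIδ ⟨v, hv⟩ (Complex.I • w) (by rw [map_smul, hw, LinearMap.smul_apply])
  rw [map_smul, ← smul_add, hδ ⟨v, hv⟩ w hw] at hIw
  have him := congrArg imV hIw
  simp only [map_neg, smul_neg, imV_I_smul, reV_cx, imV_cx] at him
  exact neg_injective him

theorem cx_add_I_smul_eq_neg_cx {A : V →L[ℝ] V} (hA : ∀ v, Φ v = A (F v) - F (A v))
    {v w : ℂ ⊗[ℝ] V} (hv : v ∈ minusI F) (hw : w - cx A v ∈ minusI F) :
    cx F w + Complex.I • w = -cx Φ v := by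
  rw [mem_minusI] at hv hw
  simp only [map_sub, reV_cx, imV_cx, sub_eq_iff_eq_add] at hw
  apply ext_reV_imV
  · simp only [map_add, map_neg, reV_cx, reV_I_smul, hA, hv.1, hw.1]
    abel
  · simp only [map_add, map_neg, imV_cx, imV_I_smul, hA, hv.2, hw.2]
    abel

theorem isTimesI_of_apply (hΦ : Φ ∈ fibreTangent c F)
    (h : ∀ v ∈ minusI F, Φ (reV v) = Ψ (imV v)) : IsTimesI F Φ Ψ := by
  obtain ⟨A, -, hA⟩ := hΦ
  refine ⟨(minusI F).mkQ ∘ₗ cx A ∘ₗ (minusI F).subtype, fun v w hw => ?_, fun v w hw => ?_⟩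
  · exact cx_add_I_smul_eq_neg_cx hA v.2 ((Submodule.Quotient.eq _).1 hw)
  · have hIv : Complex.I • (v : ℂ ⊗[ℝ] V) ∈ minusI F := (minusI F).smul_mem _ v.2
    have hw' : w - cx A (Complex.I • (v : ℂ ⊗[ℝ] V)) ∈ minusI F := by
      rw [map_smul]
      exact (Submodule.Quotient.eq _).1 hw
    rw [cx_add_I_smul_eq_neg_cx hA hIv hw']
    have him : Φ (imV (v : ℂ ⊗[ℝ] V)) = -Ψ (reV (v : ℂ ⊗[ℝ] V)) := by
      have hΦI := h _ hIv
      rw [reV_I_smul, imV_I_smul, map_neg] at hΦI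
      exact neg_eq_iff_eq_neg.1 hΦI
    apply ext_reV_imV
    · simp only [map_neg, map_smul, reV_I_smul, reV_cx, imV_cx, him, neg_neg]
    · simp only [map_neg, map_smul, imV_I_smul, imV_cx, reV_cx, h v v.2]

end FibreTangent

section Calculus

variable {G H : Type*} [NormedAddCommGroup G] [NormedSpace ℝ G] [TopologicalSpace H]
  {I : ModelWithCorners ℝ G H} {M : Type*} [TopologicalSpace M] [ChartedSpace H M]
  {F₁ F₂ : Type*} [NormedAddCommGroup F₁] [NormedSpace ℝ F₁] [NormedAddCommGroup F₂]
  [NormedSpace ℝ F₂] {x : M}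

theorem mvfderiv_clm_apply {f : M → F₁ →L[ℝ] F₂} {g : M → F₁}
    (hf : MDifferentiableAt I 𝓘(ℝ, F₁ →L[ℝ] F₂) f x) (hg : MDifferentiableAt I 𝓘(ℝ, F₁) g x)
    (X : TangentSpace I x) :
    mvfderiv I (fun y => f y (g y)) x X =
      mvfderiv I f x X (g x) + f x (mvfderiv I g x X) := by
  let f' : G →L[ℝ] F₁ →L[ℝ] F₂ := mvfderiv I f x
  let g' : G →L[ℝ] F₁ := mvfderiv I g x
  have hcomp : HasMFDerivAt I 𝓘(ℝ, F₂) (fun y => f y (g y)) x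
      (f x ∘L g' + f'.flip (g x) : G →L[ℝ] F₂) := by
    refine ⟨(hf.clm_apply hg).continuousAt, ?_⟩
    have h := HasFDerivWithinAt.clm_apply hf.hasMFDerivAt.2 hg.hasMFDerivAt.2
    simp only [writtenInExtChartAt, mfld_simps] at h ⊢
    exact h
  refine (congrArg (fun L : G →L[ℝ] F₂ => L X) hcomp.mfderiv).trans ?_
  exact add_comm _ _

theorem mvfderiv_apply_const {f : M → F₁ →L[ℝ] F₂}
    (hf : MDifferentiableAt I 𝓘(ℝ, F₁ →L[ℝ] F₂) f x) (u : F₁) (X : TangentSpace I x) :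
    mvfderiv I (fun y => f y u) x X = mvfderiv I f x X u := by
  rw [mvfderiv_clm_apply hf mdifferentiableAt_const, mvfderiv_const, zero_apply, map_zero,
    add_zero]

theorem mvfderiv_eq_of_eventuallyEq {f g : M → F₁} (h : f =ᶠ[𝓝 x] g) :
    mvfderiv I f x = mvfderiv I g x := by
  ext X
  exact congrArg (fun L : TangentSpace I x →L[ℝ] F₁ => L X) h.mfderiv_eq

end Calculus

/-! ### Coordinates on `TB` and on `End(TB)` -/

section Coordinates

variable {E : Type*} [NormedAddCommGroup E] [NormedSpace ℝ E]
  {B : Type*} [TopologicalSpace B] [ChartedSpace E B]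

variable (E) in
/-- The space of endomorphisms of `T_x B`. -/
abbrev TangentEnd (x : B) : Type _ := TangentSpace 𝓘(ℝ, E) x →L[ℝ] TangentSpace 𝓘(ℝ, E) x

/-- The map into `TB` given by a vector field along `ι`. -/
abbrev vectorAlong {M : Type*} (ι : M → B) (V : ∀ y, TangentSpace 𝓘(ℝ, E) (ι y)) :
    M → TangentBundle 𝓘(ℝ, E) B :=
  fun y => ⟨ι y, V y⟩

/-- The map into `End(TB)` given by a field of endomorphisms of `TB` along `ι`. -/
abbrev endAlong {M : Type*} (ι : M → B) (F : ∀ y, TangentEnd E (ι y)) : M → EndTotal E B :=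
  fun y => ⟨ι y, F y⟩

variable [IsManifold 𝓘(ℝ, E) ∞ B]

/-- The coordinates of the tangent vectors at `y`, in the preferred trivialization at `x`. -/
def tangentCoord (x y : B) : TangentSpace 𝓘(ℝ, E) y →L[ℝ] E :=
  (trivializationAt E (fun y : B => TangentSpace 𝓘(ℝ, E) y) x).continuousLinearMapAt ℝ y

/-- The tangent vector at `y` with given coordinates in the preferred trivialization at `x`. -/
def tangentCoordSymm (x y : B) : E →L[ℝ] TangentSpace 𝓘(ℝ, E) y :=
  (trivializationAt E (fun y : B => TangentSpace 𝓘(ℝ, E) y) x).symmL ℝ y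

variable (E) in
/-- The domain of the preferred trivialization of the tangent bundle at `x`. -/
abbrev coordDomain (x : B) : Set B :=
  (trivializationAt E (fun y : B => TangentSpace 𝓘(ℝ, E) y) x).baseSet

theorem mem_coordDomain (x : B) : x ∈ coordDomain E x :=
  FiberBundle.mem_baseSet_trivializationAt' x

theorem coordDomain_mem_nhds (x : B) : coordDomain E x ∈ 𝓝 x :=
  (trivializationAt E (fun y : B => TangentSpace 𝓘(ℝ, E) y) x).open_baseSet.mem_nhds
    (mem_coordDomain x)

theorem tangentCoordSymm_tangentCoord {x y : B} (hy : y ∈ coordDomain E x)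
    (v : TangentSpace 𝓘(ℝ, E) y) : tangentCoordSymm x y (tangentCoord x y v) = v :=
  Trivialization.symmL_continuousLinearMapAt _ hy v

theorem tangentCoord_tangentCoordSymm {x y : B} (hy : y ∈ coordDomain E x) (u : E) :
    tangentCoord x y (tangentCoordSymm x y u) = u :=
  Trivialization.continuousLinearMapAt_symmL _ hy u

@[simp] theorem tangentCoordSymm_tangentCoord_self (x : B) (v : TangentSpace 𝓘(ℝ, E) x) :
    tangentCoordSymm x x (tangentCoord x x v) = v :=
  tangentCoordSymm_tangentCoord (mem_coordDomain x) v

@[simp] theorem tangentCoord_tangentCoordSymm_self (x : B) (u : E) :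
    tangentCoord x x (tangentCoordSymm x x u) = u :=
  tangentCoord_tangentCoordSymm (mem_coordDomain x) u

theorem trivializationAt_snd_eq_tangentCoord {x y : B} (hy : y ∈ coordDomain E x)
    (v : TangentSpace 𝓘(ℝ, E) y) :
    (trivializationAt E (fun y : B => TangentSpace 𝓘(ℝ, E) y) x ⟨y, v⟩).2 =
      tangentCoord x y v := by
  rw [tangentCoord, Trivialization.continuousLinearMapAt_apply, Trivialization.linearMapAt_apply,
    if_pos hy]

theorem tangentCoord_extend [FiniteDimensional ℝ E] {x y : B} (hy : y ∈ coordDomain E x)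
    (v : TangentSpace 𝓘(ℝ, E) x) :
    tangentCoord x y (extend E v y) = tangentCoord x x v := by
  rw [← tangentCoord_tangentCoordSymm hy (tangentCoord x x v)]
  exact congrArg _ (extend_eq v hy)

theorem mvfderiv_tangentCoord_extend [FiniteDimensional ℝ E] (x : B)
    (v : TangentSpace 𝓘(ℝ, E) x) :
    mvfderiv 𝓘(ℝ, E) (fun y => tangentCoord x y (extend E v y)) x = 0 := by
  have h : (fun y => tangentCoord x y (extend E v y)) =ᶠ[𝓝 x] fun _ => tangentCoord x x v := by
    filter_upwards [coordDomain_mem_nhds (E := E) x] with y hy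
    exact tangentCoord_extend hy v
  rw [mvfderiv_eq_of_eventuallyEq h, mvfderiv_const]

/-- The matrix of an endomorphism `w` of a tangent space, in the preferred trivialization at `x`
of the tangent bundle. -/
def endCoord (x : B) (w : EndTotal E B) : E →L[ℝ] E :=
  tangentCoord x w.1 ∘L w.2 ∘L tangentCoordSymm x w.1

theorem tangentCoord_apply {x : B} (w : EndTotal E B) (hw : w.1 ∈ coordDomain E x)
    (v : TangentSpace 𝓘(ℝ, E) w.1) :
    tangentCoord x w.1 (w.2 v) = endCoord x w (tangentCoord x w.1 v) := by
  simp only [endCoord, ContinuousLinearMap.comp_apply, tangentCoordSymm_tangentCoord hw]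

/-- The differential of the projection `End(TB) → B`. -/
abbrev endProjDeriv (z : EndTotal E B) :
    TangentSpace (endModel E) z →L[ℝ] TangentSpace 𝓘(ℝ, E) z.1 :=
  mfderiv (endModel E) 𝓘(ℝ, E) (fun w : EndTotal E B => w.1) z

theorem mdifferentiableAt_endProj (z : EndTotal E B) :
    MDifferentiableAt (endModel E) 𝓘(ℝ, E) (fun w : EndTotal E B => w.1) z :=
  mdifferentiableAt_proj _

theorem mdifferentiableAt_endCoord (z : EndTotal E B) :
    MDifferentiableAt (endModel E) 𝓘(ℝ, E →L[ℝ] E) (endCoord z.1) z :=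
  ((mdifferentiableAt_hom_bundle (fun w : EndTotal E B => w)).1 mdifferentiableAt_id).2

theorem mfderiv_chartAt_endTotal_apply (z : EndTotal E B) (ξ : TangentSpace (endModel E) z) :
    (mfderiv (endModel E) (endModel E) (chartAt (ModelProd E (E →L[ℝ] E)) z) z ξ :
        E × (E →L[ℝ] E)) =
      (mfderiv 𝓘(ℝ, E) 𝓘(ℝ, E) (chartAt E z.1) z.1 (endProjDeriv z ξ),
        mvfderiv (endModel E) (endCoord z.1) z ξ) := by
  have hchart : (chartAt (ModelProd E (E →L[ℝ] E)) z : EndTotal E B → E × (E →L[ℝ] E)) =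
      fun w => (chartAt E z.1 w.1, endCoord z.1 w) := funext fun w => hom_chart z w
  have hd : MDifferentiableAt 𝓘(ℝ, E) 𝓘(ℝ, E) (chartAt E z.1) z.1 :=
    (mdifferentiable_chart (I := 𝓘(ℝ, E)) z.1).mdifferentiableAt (mem_chart_source E z.1)
  have hprod := mfderiv_prodMk (hd.comp z (mdifferentiableAt_endProj z))
    (mdifferentiableAt_endCoord z)
  rw [chartedSpaceSelf_prod] at hprod
  refine (congrArg (fun f => mfderiv (endModel E) (endModel E) f z ξ) hchart).trans ?_
  refine (congrArg (fun L : TangentSpace (endModel E) z →L[ℝ] E × (E →L[ℝ] E) => L ξ)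
    hprod).trans ?_
  exact Prod.ext (mfderiv_comp_apply z hd (mdifferentiableAt_endProj z) ξ) rfl

theorem eq_zero_of_endProjDeriv_endCoord {z : EndTotal E B} {ξ : TangentSpace (endModel E) z}
    (hproj : endProjDeriv z ξ = 0) (hcoord : mvfderiv (endModel E) (endCoord z.1) z ξ = 0) :
    ξ = 0 := by
  refine (mdifferentiable_chart (I := endModel E) z).mfderiv_injective
    (mem_chart_source (ModelProd E (E →L[ℝ] E)) z) ?_
  refine Eq.trans ?_ (ContinuousLinearMap.map_zero _).symm
  refine (mfderiv_chartAt_endTotal_apply z ξ).trans ?_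
  rw [hproj, hcoord]
  exact Prod.ext (map_zero _) rfl

section Along

variable {G H : Type*} [NormedAddCommGroup G] [NormedSpace ℝ G] [TopologicalSpace H]
  {I : ModelWithCorners ℝ G H} {M : Type*} [TopologicalSpace M] [ChartedSpace H M]
  {ι : M → B} {V : ∀ y, TangentSpace 𝓘(ℝ, E) (ι y)} {F : ∀ y, TangentEnd E (ι y)} {x : M}

theorem mdifferentiableAt_vectorAlong_iff :
    MDifferentiableAt I 𝓘(ℝ, E).tangent (vectorAlong ι V) x ↔
      MDifferentiableAt I 𝓘(ℝ, E) ι x ∧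
        MDifferentiableAt I 𝓘(ℝ, E) (fun y => tangentCoord (ι x) (ι y) (V y)) x := by
  rw [mdifferentiableAt_totalSpace]
  refine and_congr_right fun h => Filter.EventuallyEq.mdifferentiableAt_iff ?_
  filter_upwards [h.continuousAt (coordDomain_mem_nhds (E := E) (ι x))] with y hy
  exact trivializationAt_snd_eq_tangentCoord hy _

theorem mdifferentiableAt_endTotal_iff {f : M → EndTotal E B} :
    MDifferentiableAt I (endModel E) f x ↔
      MDifferentiableAt I 𝓘(ℝ, E) (fun y => (f y).1) x ∧
        MDifferentiableAt I 𝓘(ℝ, E →L[ℝ] E) (fun y => endCoord (f x).1 (f y)) x :=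
  mdifferentiableAt_hom_bundle f

theorem mdifferentiableAt_vectorAlong_apply
    (hF : MDifferentiableAt I (endModel E) (endAlong ι F) x)
    (hV : MDifferentiableAt I 𝓘(ℝ, E).tangent (vectorAlong ι V) x) :
    MDifferentiableAt I 𝓘(ℝ, E).tangent (vectorAlong ι fun y => F y (V y)) x := by
  rw [mdifferentiableAt_vectorAlong_iff] at hV ⊢
  rw [mdifferentiableAt_endTotal_iff] at hF
  refine ⟨hV.1, (hF.2.clm_apply hV.2).congr_of_eventuallyEq ?_⟩
  filter_upwards [hV.1.continuousAt (coordDomain_mem_nhds (E := E) (ι x))] with y hy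
  exact tangentCoord_apply (endAlong ι F y) hy _

theorem endProjDeriv_mfderiv (hF : MDifferentiableAt I (endModel E) (endAlong ι F) x)
    (X : TangentSpace I x) :
    endProjDeriv (endAlong ι F x) (mfderiv I (endModel E) (endAlong ι F) x X) =
      mfderiv I 𝓘(ℝ, E) ι x X :=
  (mfderiv_comp_apply x (mdifferentiableAt_endProj (endAlong ι F x)) hF X).symm

end Along

theorem mdifferentiableAt_field_iff {Y : ∀ y : B, TangentSpace 𝓘(ℝ, E) y} {x : B} :
    MDiffAt (T% Y) x ↔ MDifferentiableAt 𝓘(ℝ, E) 𝓘(ℝ, E) (fun y => tangentCoord x y (Y y)) x :=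
  (mdifferentiableAt_vectorAlong_iff (ι := fun y : B => y) (V := Y)).trans
    (and_iff_right mdifferentiableAt_id)

end Coordinates

/-! ### Covariant derivatives along a map and the induced connection on `End(TB)` -/

section Connections

variable {E : Type*} [NormedAddCommGroup E] [NormedSpace ℝ E] [FiniteDimensional ℝ E]
  {B : Type*} [TopologicalSpace B] [ChartedSpace E B] [IsManifold 𝓘(ℝ, E) ∞ B]
  (D : CovariantDerivative 𝓘(ℝ, E) E (fun x : B => TangentSpace 𝓘(ℝ, E) x))

/-- The Christoffel endomorphism `Γ_X v = D_X v`, where `v` is extended with constant coordinates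
in the preferred trivialization at `x`. -/
def christoffel (x : B) : TangentSpace 𝓘(ℝ, E) x →ₗ[ℝ] TangentEnd E x where
  toFun X := LinearMap.toContinuousLinearMap
    { toFun := fun v => D (extend E v) x X
      map_add' := fun v w => by rw [conn_extend_add]; rfl
      map_smul' := fun a v => by rw [conn_extend_smul]; rfl }
  map_add' X Y := by
    ext v
    exact map_add (D (extend E v) x) X Y
  map_smul' a X := by
    ext v
    exact map_smul (D (extend E v) x) a X

theorem christoffel_apply (x : B) (X v : TangentSpace 𝓘(ℝ, E) x) :
    christoffel D x X v = D (extend E v) x X := rfl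

theorem conn_eq_add_christoffel {Y : ∀ y : B, TangentSpace 𝓘(ℝ, E) y} {x : B}
    (hY : MDiffAt (T% Y) x) (X : TangentSpace 𝓘(ℝ, E) x) :
    D Y x X =
      tangentCoordSymm x x (mvfderiv 𝓘(ℝ, E) (fun y => tangentCoord x y (Y y)) x X) +
        christoffel D x X (Y x) := by
  have htensor : TensorialAt 𝓘(ℝ, E) E (fun Y : ∀ y : B, TangentSpace 𝓘(ℝ, E) y =>
      D Y x X -
        tangentCoordSymm x x (mvfderiv 𝓘(ℝ, E) (fun y => tangentCoord x y (Y y)) x X)) x := by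
    constructor
    · intro f σ hf hσ
      have hcoord : (fun y => tangentCoord x y ((f • σ) y)) =
          f • fun y => tangentCoord x y (σ y) := by
        ext y; exact map_smul _ _ _
      rw [hcoord, mvfderiv_smul hf (mdifferentiableAt_field_iff.1 hσ),
        D.isCovariantDerivativeOnUniv.leibniz hσ hf]
      simp [smul_sub]
    · intro σ τ hσ hτ
      have hcoord : (fun y => tangentCoord x y ((σ + τ) y)) =
          (fun y => tangentCoord x y (σ y)) + fun y => tangentCoord x y (τ y) := by
        ext y; exact map_add _ _ _
      rw [hcoord, mvfderiv_add (mdifferentiableAt_field_iff.1 hσ)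
        (mdifferentiableAt_field_iff.1 hτ), D.isCovariantDerivativeOnUniv.add hσ hτ]
      simp only [add_apply, map_add]
      abel
  have h := htensor.pointwise hY (mdifferentiableAt_extend 𝓘(ℝ, E) E (Y x))
    (by simp only [extend_apply_self])
  rw [mvfderiv_tangentCoord_extend, zero_apply, map_zero, sub_zero, ← christoffel_apply] at h
  exact sub_eq_iff_eq_add'.1 h

/-- The vertical part, with respect to the connection induced by `D` on `End(TB)`, of a vector
tangent to `End(TB)`. -/
def vertPart (z : EndTotal E B) : TangentSpace (endModel E) z →ₗ[ℝ] TangentEnd E z.1 where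
  toFun ξ := tangentCoordSymm z.1 z.1 ∘L mvfderiv (endModel E) (endCoord z.1) z ξ ∘L
      tangentCoord z.1 z.1 +
    (christoffel D z.1 (endProjDeriv z ξ) ∘L z.2 - z.2 ∘L christoffel D z.1 (endProjDeriv z ξ))
  map_add' ξ η := by
    rw [(mvfderiv (endModel E) (endCoord z.1) z).map_add, (endProjDeriv z).map_add, map_add]
    ext v
    simp only [ContinuousLinearMap.comp_apply, add_apply, sub_apply, map_add]
    abel
  map_smul' a ξ := by
    rw [(mvfderiv (endModel E) (endCoord z.1) z).map_smul, (endProjDeriv z).map_smul, map_smul]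
    ext v
    simp only [ContinuousLinearMap.comp_apply, add_apply, sub_apply, map_smul, smul_apply,
      RingHom.id_apply, smul_add, smul_sub]

theorem vertPart_eq (z : EndTotal E B) (ξ : TangentSpace (endModel E) z) :
    vertPart D z ξ =
      tangentCoordSymm z.1 z.1 ∘L mvfderiv (endModel E) (endCoord z.1) z ξ ∘L
          tangentCoord z.1 z.1 +
        (christoffel D z.1 (endProjDeriv z ξ) ∘L z.2 -
          z.2 ∘L christoffel D z.1 (endProjDeriv z ξ)) := rfl

theorem eq_zero_of_endProjDeriv_vertPart {z : EndTotal E B} {ξ : TangentSpace (endModel E) z}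
    (hproj : endProjDeriv z ξ = 0) (hvert : vertPart D z ξ = 0) : ξ = 0 := by
  refine eq_zero_of_endProjDeriv_endCoord hproj ?_
  rw [vertPart_eq, hproj, map_zero, ContinuousLinearMap.zero_comp, ContinuousLinearMap.comp_zero,
    sub_zero, add_zero] at hvert
  ext u
  have h := congrArg (fun Φ : TangentEnd E z.1 =>
    tangentCoord z.1 z.1 (Φ (tangentCoordSymm z.1 z.1 u))) hvert
  simpa using h

variable {E' : Type*} [NormedAddCommGroup E'] [NormedSpace ℝ E']
  {M : Type*} [TopologicalSpace M] [ChartedSpace E' M]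
  {ι : M → B} {F : ∀ y, TangentEnd E (ι y)} {V : ∀ y, TangentSpace 𝓘(ℝ, E) (ι y)} {x : M}

theorem pullbackDeriv_eq (hι : ContinuousAt ι x) (V : ∀ y, TangentSpace 𝓘(ℝ, E) (ι y))
    (X : TangentSpace 𝓘(ℝ, E') x) :
    pullbackDeriv D ι V x X =
      tangentCoordSymm (ι x) (ι x)
          (mvfderiv 𝓘(ℝ, E') (fun y => tangentCoord (ι x) (ι y) (V y)) x X) +
        christoffel D (ι x) (dif E E' ι x X) (V x) := by
  have hcoord : (fun y => (trivializationAt E (fun y : B => TangentSpace 𝓘(ℝ, E) y) (ι x)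
      ⟨ι y, V y⟩).2) =ᶠ[𝓝 x] fun y => tangentCoord (ι x) (ι y) (V y) := by
    filter_upwards [hι (coordDomain_mem_nhds (E := E) (ι x))] with y hy
    exact trivializationAt_snd_eq_tangentCoord hy _
  simp only [pullbackDeriv, mvfderiv_eq_of_eventuallyEq hcoord]
  rfl

/-- The covariant derivative `D_X F` of a field of endomorphisms along `ι`, encoded as the vertical
part of the derivative of `F`, seen as a map into `End(TB)`. -/
def endDeriv (ι : M → B) (F : ∀ y, TangentEnd E (ι y)) (x : M) (X : TangentSpace 𝓘(ℝ, E') x) :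
    TangentEnd E (ι x) :=
  vertPart D (endAlong ι F x) (mfderiv 𝓘(ℝ, E') (endModel E) (endAlong ι F) x X)

theorem endDeriv_eq (hF : MDifferentiableAt 𝓘(ℝ, E') (endModel E) (endAlong ι F) x)
    (X : TangentSpace 𝓘(ℝ, E') x) :
    endDeriv D ι F x X =
      tangentCoordSymm (ι x) (ι x) ∘L
          mvfderiv 𝓘(ℝ, E') (fun y => endCoord (ι x) (endAlong ι F y)) x X ∘L
          tangentCoord (ι x) (ι x) +
        (christoffel D (ι x) (dif E E' ι x X) ∘L F x -
          F x ∘L christoffel D (ι x) (dif E E' ι x X)) := by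
  have hcoord : mvfderiv (endModel E) (endCoord (ι x)) (endAlong ι F x)
      (mfderiv 𝓘(ℝ, E') (endModel E) (endAlong ι F) x X) =
      mvfderiv 𝓘(ℝ, E') (fun y => endCoord (ι x) (endAlong ι F y)) x X :=
    (mfderiv_comp_apply x (mdifferentiableAt_endCoord (endAlong ι F x)) hF X).symm
  rw [endDeriv, vertPart_eq, endProjDeriv_mfderiv hF]
  exact congrArg (fun L : E →L[ℝ] E => tangentCoordSymm (ι x) (ι x) ∘L L ∘L
    tangentCoord (ι x) (ι x) + _) hcoord

theorem pullbackDeriv_apply (hF : MDifferentiableAt 𝓘(ℝ, E') (endModel E) (endAlong ι F) x)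
    (hV : MDifferentiableAt 𝓘(ℝ, E') 𝓘(ℝ, E).tangent (vectorAlong ι V) x)
    (X : TangentSpace 𝓘(ℝ, E') x) :
    pullbackDeriv D ι (fun y => F y (V y)) x X =
      endDeriv D ι F x X (V x) + F x (pullbackDeriv D ι V x X) := by
  rw [endDeriv_eq D hF]
  rw [mdifferentiableAt_vectorAlong_iff] at hV
  rw [mdifferentiableAt_endTotal_iff] at hF
  have hι := hV.1.continuousAt
  have hcoord : (fun y => tangentCoord (ι x) (ι y) (F y (V y))) =ᶠ[𝓝 x] fun y =>
      endCoord (ι x) (endAlong ι F y) (tangentCoord (ι x) (ι y) (V y)) := by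
    filter_upwards [hι (coordDomain_mem_nhds (E := E) (ι x))] with y hy
    exact tangentCoord_apply (endAlong ι F y) hy (V y)
  rw [pullbackDeriv_eq D hι, pullbackDeriv_eq D hι, mvfderiv_eq_of_eventuallyEq hcoord,
    mvfderiv_clm_apply hF.2 hV.2]
  simp only [endCoord, ContinuousLinearMap.comp_apply, add_apply, sub_apply, map_add,
    tangentCoordSymm_tangentCoord_self]
  abel

end Connections

section Horizontal

variable {E : Type*} [NormedAddCommGroup E] [NormedSpace ℝ E]
  {B : Type*} [TopologicalSpace B] [ChartedSpace E B]

theorem dif_id (x : B) (X : TangentSpace 𝓘(ℝ, E) x) : dif E E (fun y : B => y) x X = X :=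
  congrArg (fun L : TangentEnd E x => L X) mfderiv_id

variable [IsManifold 𝓘(ℝ, E) ∞ B]

theorem endCoord_add_smul (z : EndTotal E B) (Φ : TangentEnd E z.1) (t : ℝ) :
    endCoord z.1 (⟨z.1, z.2 + t • Φ⟩ : EndTotal E B) =
      endCoord z.1 z + t • endCoord z.1 (⟨z.1, Φ⟩ : EndTotal E B) := by
  ext u
  simp [endCoord]

theorem mdifferentiableAt_add_smul (z : EndTotal E B) (Φ : TangentEnd E z.1) :
    MDifferentiableAt 𝓘(ℝ, ℝ) (endModel E)
      (fun t : ℝ => (⟨z.1, z.2 + t • Φ⟩ : EndTotal E B)) 0 := by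
  rw [mdifferentiableAt_endTotal_iff]
  refine ⟨mdifferentiableAt_const, ?_⟩
  simp only [endCoord_add_smul]
  exact (((differentiableAt_id (𝕜 := ℝ)).smul_const _).const_add _).mdifferentiableAt

theorem endProjDeriv_vertLift (z : EndTotal E B) (Φ : TangentEnd E z.1) :
    endProjDeriv z (vertLift z Φ) = 0 := by
  refine (mfderiv_comp_apply_of_eq (0 : ℝ) (mdifferentiableAt_endProj z)
    (mdifferentiableAt_add_smul z Φ) (by rw [zero_smul, add_zero]) (1 : ℝ)).symm.trans ?_
  exact congrArg (fun L : ℝ →L[ℝ] E => L 1) (mfderiv_const (c := z.1))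

theorem mvfderiv_endCoord_vertLift (z : EndTotal E B) (Φ : TangentEnd E z.1) :
    mvfderiv (endModel E) (endCoord z.1) z (vertLift z Φ) =
      endCoord z.1 (⟨z.1, Φ⟩ : EndTotal E B) := by
  refine (mfderiv_comp_apply_of_eq (0 : ℝ) (mdifferentiableAt_endCoord z)
    (mdifferentiableAt_add_smul z Φ) (by rw [zero_smul, add_zero]) (1 : ℝ)).symm.trans ?_
  have hline : (endCoord z.1 ∘ fun t : ℝ => (⟨z.1, z.2 + t • Φ⟩ : EndTotal E B)) =
      fun t : ℝ => endCoord z.1 z + t • endCoord z.1 (⟨z.1, Φ⟩ : EndTotal E B) :=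
    funext fun t => endCoord_add_smul z Φ t
  have hderiv := ((hasDerivAt_id (0 : ℝ)).smul_const
    (endCoord z.1 (⟨z.1, Φ⟩ : EndTotal E B))).const_add (endCoord z.1 z)
  rw [hline, mfderiv_eq_fderiv]
  exact hderiv.deriv.trans (one_smul ℝ _)

theorem exists_section_of_coord (x : B) (F : TangentEnd E x) (L : E →L[ℝ] E →L[ℝ] E) :
    ∃ σ : ∀ y : B, TangentEnd E y, σ x = F ∧
      MDifferentiableAt 𝓘(ℝ, E) (endModel E) (endAlong (fun y => y) σ) x ∧
      ∀ X : TangentSpace 𝓘(ℝ, E) x,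
        mvfderiv 𝓘(ℝ, E) (fun y => endCoord x (endAlong (fun y => y) σ y)) x X =
          L (tangentCoord x x X) := by
  let φ : B → E := extChartAt 𝓘(ℝ, E) x
  let G : B → E →L[ℝ] E :=
    (fun _ => endCoord x (⟨x, F⟩ : EndTotal E B) - L (φ x)) + fun y => L (φ y)
  let σ : ∀ y : B, TangentEnd E y := fun y => tangentCoordSymm x y ∘L G y ∘L tangentCoord x y
  have hcoord : (fun y => endCoord x (endAlong (fun y => y) σ y)) =ᶠ[𝓝 x] G := by
    filter_upwards [coordDomain_mem_nhds (E := E) x] with y hy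
    ext u
    simp only [endCoord, σ, ContinuousLinearMap.comp_apply, tangentCoord_tangentCoordSymm hy]
  have hφ : MDifferentiableAt 𝓘(ℝ, E) 𝓘(ℝ, E) φ x :=
    mdifferentiableAt_extChartAt (mem_chart_source E x)
  have hLφ : MDifferentiableAt 𝓘(ℝ, E) 𝓘(ℝ, E →L[ℝ] E) (fun y => L (φ y)) x :=
    L.mdifferentiableAt.comp x hφ
  have hG : MDifferentiableAt 𝓘(ℝ, E) 𝓘(ℝ, E →L[ℝ] E) G x := mdifferentiableAt_const.add hLφ
  refine ⟨σ, ?_, ?_, fun X => ?_⟩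
  · ext v
    simp [σ, G, endCoord]
  · exact mdifferentiableAt_endTotal_iff.2
      ⟨mdifferentiableAt_id, hG.congr_of_eventuallyEq hcoord⟩
  · rw [mvfderiv_eq_of_eventuallyEq hcoord, mvfderiv_add mdifferentiableAt_const hLφ,
      mvfderiv_const, add_apply]
    refine (zero_add _).trans ?_
    refine (mfderiv_comp_apply x (L.mdifferentiableAt (x := φ x)) hφ X).trans ?_
    rw [L.mfderiv_eq, ← TangentBundle.continuousLinearMapAt_trivializationAt
      (mem_chart_source E x)]
    rfl

variable [FiniteDimensional ℝ E]
  (D : CovariantDerivative 𝓘(ℝ, E) E (fun x : B => TangentSpace 𝓘(ℝ, E) x))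

theorem pullbackDeriv_id {Y : ∀ y : B, TangentSpace 𝓘(ℝ, E) y} {x : B} (hY : MDiffAt (T% Y) x)
    (X : TangentSpace 𝓘(ℝ, E) x) :
    pullbackDeriv D (fun y : B => y) Y x X = D Y x X := by
  rw [pullbackDeriv_eq D (ι := fun y : B => y) continuousAt_id, conn_eq_add_christoffel D hY,
    dif_id]

theorem conn_apply {σ : ∀ y : B, TangentEnd E y} {Y : ∀ y : B, TangentSpace 𝓘(ℝ, E) y} {x : B}
    (hσ : MDifferentiableAt 𝓘(ℝ, E) (endModel E) (endAlong (fun y => y) σ) x)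
    (hY : MDiffAt (T% Y) x) (X : TangentSpace 𝓘(ℝ, E) x) :
    D (fun y => σ y (Y y)) x X =
      endDeriv D (fun y : B => y) σ x X (Y x) + σ x (D Y x X) := by
  rw [← pullbackDeriv_id D hY, ← pullbackDeriv_id D (mdifferentiableAt_vectorAlong_apply hσ hY)]
  exact pullbackDeriv_apply D hσ hY X

theorem vertPart_vertLift (z : EndTotal E B) (Φ : TangentEnd E z.1) :
    vertPart D z (vertLift z Φ) = Φ := by
  rw [vertPart_eq, endProjDeriv_vertLift, map_zero, mvfderiv_endCoord_vertLift]
  ext v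
  simp [endCoord]

theorem exists_endDeriv_eq_zero (x : B) (F : TangentEnd E x) :
    ∃ σ : ∀ y : B, TangentEnd E y, σ x = F ∧
      MDifferentiableAt 𝓘(ℝ, E) (endModel E) (endAlong (fun y => y) σ) x ∧
      ∀ X : TangentSpace 𝓘(ℝ, E) x, endDeriv D (fun y : B => y) σ x X = 0 := by
  let Γ : E → TangentEnd E x := fun u => christoffel D x (tangentCoordSymm x x u)
  let L : E →L[ℝ] E →L[ℝ] E := LinearMap.toContinuousLinearMap
    { toFun := fun u => tangentCoord x x ∘L (F ∘L Γ u - Γ u ∘L F) ∘L tangentCoordSymm x x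
      map_add' := fun u v => by ext w; simp [Γ]; abel
      map_smul' := fun a v => by ext w; simp [Γ, smul_sub] }
  obtain ⟨σ, rfl, hσ, hL⟩ := exists_section_of_coord x F L
  refine ⟨σ, rfl, hσ, fun X => ?_⟩
  rw [endDeriv_eq D hσ, hL, dif_id]
  ext v
  simp [L, Γ]

theorem mem_horizontal_iff {z : EndTotal E B} {ξ : TangentSpace (endModel E) z} :
    ξ ∈ horizontal D z ↔ vertPart D z ξ = 0 := by
  obtain ⟨x, F⟩ := z
  constructor
  · intro hξ
    change ξ ∈ LinearMap.ker (vertPart D _)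
    refine Submodule.span_le.2 ?_ hξ
    rintro _ ⟨σ, X, (hσx : σ x = F), hσ, hparallel, rfl⟩
    subst hσx
    change endDeriv D (fun y : B => y) σ x X = 0
    ext v
    have hv := mdifferentiableAt_extend 𝓘(ℝ, E) E v
    have hleibniz := conn_apply D hσ hv X
    rw [hparallel _ hv, extend_apply_self] at hleibniz
    exact right_eq_add.1 hleibniz
  · intro hξ
    obtain ⟨σ, rfl, hσ, hparallel⟩ := exists_endDeriv_eq_zero D x F
    let X : TangentSpace 𝓘(ℝ, E) x := endProjDeriv ⟨x, σ x⟩ ξ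
    refine Submodule.subset_span ⟨σ, X, rfl, hσ, fun Y hY => ?_, ?_⟩
    · exact (conn_apply D hσ hY X).trans (by rw [hparallel, zero_apply, zero_add])
    · rw [← sub_eq_zero]
      refine eq_zero_of_endProjDeriv_vertPart D ?_ ?_
      · rw [(endProjDeriv (⟨x, σ x⟩ : EndTotal E B)).map_sub]
        exact sub_eq_zero.2 ((endProjDeriv_mfderiv hσ X).trans (dif_id x X)).symm
      · rw [map_sub, hξ, zero_sub, neg_eq_zero]
        exact hparallel X

end Horizontal

/-! ### Holomorphic maps into the bundle of isotropic spaces -/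

section Holomorphic

variable {E : Type*} [NormedAddCommGroup E] [NormedSpace ℝ E]
  {B : Type*} [TopologicalSpace B] [ChartedSpace E B] [IsManifold 𝓘(ℝ, E) ∞ B]

theorem cx_endProjDeriv_vertLift (z : EndTotal E B) (Φ Ψ : TangentEnd E z.1) :
    cx (endProjDeriv z) ((1 : ℂ) ⊗ₜ[ℝ] vertLift z Φ - Complex.I ⊗ₜ[ℝ] vertLift z Ψ) = 0 := by
  simp only [map_sub, cx, LinearMap.baseChange_tmul, ContinuousLinearMap.coe_coe,
    endProjDeriv_vertLift, TensorProduct.tmul_zero, sub_zero]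

variable [FiniteDimensional ℝ E]
  {c : ∀ x : B, Set (TangentSpace 𝓘(ℝ, E) x →L[ℝ] TangentSpace 𝓘(ℝ, E) x →L[ℝ] ℝ)}
  {D : CovariantDerivative 𝓘(ℝ, E) E (fun x : B => TangentSpace 𝓘(ℝ, E) x)}

variable (D) in
/-- The complexified vectors tangent to `End(TB)` at `z` whose projection is in `q = ker (z + i)`
and whose vertical part vanishes on the conjugate of `q`. On the complexified tangent space of the
bundle of isotropic spaces this is `distG'`. -/
def typeSubmodule (z : EndTotal E B) : Submodule ℂ (ℂ ⊗[ℝ] TangentSpace (endModel E) z) where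
  carrier := {ζ | cx (endProjDeriv z) ζ ∈ minusI z.2 ∧
    ∀ v ∈ minusI z.2, vertPart D z (reV ζ) (reV v) + vertPart D z (imV ζ) (imV v) = 0}
  zero_mem' := by
    refine ⟨by rw [map_zero]; exact zero_mem _, fun v _ => ?_⟩
    simp only [map_zero, zero_apply, add_zero]
  add_mem' := by
    rintro ζ η ⟨hζ, hζv⟩ ⟨hη, hηv⟩
    refine ⟨by rw [map_add]; exact add_mem hζ hη, fun v hv => ?_⟩
    simp only [map_add, add_apply]
    rw [add_add_add_comm, hζv v hv, hηv v hv, add_zero]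
  smul_mem' := by
    rintro a ζ ⟨hζ, hζv⟩
    refine ⟨by rw [map_smul]; exact Submodule.smul_mem _ _ hζ, fun v hv => ?_⟩
    have hv' := hζv v hv
    have hIv := hζv _ ((minusI z.2).smul_mem Complex.I hv)
    simp only [reV_I_smul, imV_I_smul, map_neg] at hIv
    rw [add_eq_zero_iff_eq_neg] at hv'
    rw [neg_add_eq_zero] at hIv
    simp only [reV_smul, imV_smul, map_add, map_sub, map_smul, add_apply, sub_apply, smul_apply,
      hv', hIv]
    module

theorem distG'_le_typeSubmodule (z : EndTotal E B) : distG' c D z ≤ typeSubmodule D z := by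
  refine sup_le ?_ (Submodule.span_le.2 ?_)
  · rintro ζ ⟨hhor, hproj⟩
    obtain ⟨hre, him⟩ := mem_baseChange_complex_iff.1 hhor
    refine ⟨hproj, fun v _ => ?_⟩
    rw [(mem_horizontal_iff D).1 hre, (mem_horizontal_iff D).1 him, zero_apply, zero_apply,
      add_zero]
  · rintro _ ⟨Φ, -, Ψ, -, hΦΨ, rfl⟩
    refine ⟨?_, fun v hv => ?_⟩
    · rw [cx_endProjDeriv_vertLift]
      exact zero_mem _
    · simp only [map_sub, reV_tmul, imV_tmul, Complex.one_re, Complex.one_im, Complex.I_re,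
        Complex.I_im, one_smul, zero_smul, sub_zero, zero_sub, map_neg, neg_apply,
        vertPart_vertLift]
      rw [hΦΨ.apply_reV hv, add_neg_cancel]

theorem mem_distG' {z : EndTotal E B} {ζ : ℂ ⊗[ℝ] TangentSpace (endModel E) z}
    (hζ : ζ ∈ typeSubmodule D z) (hre : vertPart D z (reV ζ) ∈ fibreTangent (c z.1) z.2)
    (him : vertPart D z (imV ζ) ∈ fibreTangent (c z.1) z.2) : ζ ∈ distG' c D z := by
  obtain ⟨hproj, hvert⟩ := hζ
  let η : ℂ ⊗[ℝ] TangentSpace (endModel E) z :=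
    (1 : ℂ) ⊗ₜ[ℝ] vertLift z (vertPart D z (reV ζ)) -
      Complex.I ⊗ₜ[ℝ] vertLift z (-vertPart D z (imV ζ))
  have hη : η ∈ vert10 c z := by
    refine Submodule.subset_span ⟨_, hre, _, neg_mem_fibreTangent him,
      isTimesI_of_apply hre fun v hv => ?_, rfl⟩
    rw [neg_apply]
    exact eq_neg_of_add_eq_zero_left (hvert v hv)
  have hηre : reV η = vertLift z (vertPart D z (reV ζ)) := by simp [η]
  have hηim : imV η = -vertLift z (-vertPart D z (imV ζ)) := by simp [η]
  rw [← sub_add_cancel ζ η]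
  refine Submodule.add_mem_sup ⟨mem_baseChange_complex_iff.2 ⟨?_, ?_⟩, ?_⟩ hη
  · rw [mem_horizontal_iff, map_sub, hηre, map_sub, vertPart_vertLift, sub_self]
  · rw [mem_horizontal_iff, map_sub, hηim, map_sub, map_neg, vertPart_vertLift, neg_neg, sub_self]
  · change cx (endProjDeriv z) (ζ - η) ∈ minusI z.2
    rwa [map_sub, cx_endProjDeriv_vertLift, sub_zero]

theorem isHolomorphic_iff {E' : Type*} [NormedAddCommGroup E'] [NormedSpace ℝ E']
    {M : Type*} [TopologicalSpace M] [ChartedSpace E' M] {ι : M → B}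
    {F : ∀ y, TangentEnd E (ι y)} {J : ∀ y : M, TangentEnd E' y}
    (hF : ∀ x, MDifferentiableAt 𝓘(ℝ, E') (endModel E) (endAlong ι F) x)
    (hfib : ∀ (x : M) (X : TangentSpace 𝓘(ℝ, E') x),
      endDeriv D ι F x X ∈ fibreTangent (c (ι x)) (F x))
    (hJF : ∀ x v, F x (dif E E' ι x v) = dif E E' ι x (J x v)) :
    IsHolomorphic (endModel E) J (endAlong ι F) (distG' c D) ↔
      ∀ x, ∀ Z ∈ minusI (J x), ∀ v ∈ minusI (F x),
        endDeriv D ι F x (reV Z) (reV v) + endDeriv D ι F x (imV Z) (imV v) = 0 := by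
  constructor
  · intro h x Z hZ v hv
    have hvert := (distG'_le_typeSubmodule _ (h x (Submodule.mem_map_of_mem hZ))).2 v hv
    rwa [reV_cx, imV_cx] at hvert
  · rintro h x _ ⟨Z, hZ, rfl⟩
    refine mem_distG' ⟨?_, fun v hv => ?_⟩ ?_ ?_
    · obtain ⟨hre, him⟩ := mem_minusI.1 hZ
      rw [mem_minusI, reV_cx, imV_cx, reV_cx, imV_cx, endProjDeriv_mfderiv (hF x),
        endProjDeriv_mfderiv (hF x)]
      exact ⟨by rw [hJF, hre], by rw [hJF, him, map_neg]⟩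
    · rw [reV_cx, imV_cx]
      exact h x Z hZ v hv
    · rw [reV_cx]
      exact hfib x _
    · rw [imV_cx]
      exact hfib x _

end Holomorphic

/-! ### Covariant derivatives of `f`-structures -/

section Fibre

variable {E : Type*} [NormedAddCommGroup E] [NormedSpace ℝ E]
  {B : Type*} [TopologicalSpace B] [ChartedSpace E B] [IsManifold 𝓘(ℝ, E) ∞ B]
  (g : ContMDiffRiemannianMetric 𝓘(ℝ, E) ∞ E (fun x : B => TangentSpace 𝓘(ℝ, E) x))

/-- The matrix of a Riemannian metric at `y`, in the preferred trivialization at `x` of the tangent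
bundle. -/
def metricCoord (x y : B) : E →L[ℝ] E →L[ℝ] ℝ :=
  (trivializationAt (E →L[ℝ] E →L[ℝ] ℝ)
    (fun y : B => TangentSpace 𝓘(ℝ, E) y →L[ℝ] TangentSpace 𝓘(ℝ, E) y →L[ℝ] ℝ) x
    ⟨y, g.inner y⟩).2

theorem metricCoord_apply {x y : B} (hy : y ∈ coordDomain E x) (u w : E) :
    metricCoord g x y u w = g.inner y (tangentCoordSymm x y u) (tangentCoordSymm x y w) := by
  have hy' : y ∈ (trivializationAt (E →L[ℝ] ℝ)
      (fun y : B => TangentSpace 𝓘(ℝ, E) y →L[ℝ] ℝ) x).baseSet := ⟨hy, Set.mem_univ _⟩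
  simp [metricCoord, hom_trivializationAt_apply, ContinuousLinearMap.inCoordinates,
    tangentCoordSymm, Trivialization.coe_linearMapAt_of_mem _ hy']

theorem metricCoord_tangentCoord {x y : B} (hy : y ∈ coordDomain E x)
    (v w : TangentSpace 𝓘(ℝ, E) y) :
    metricCoord g x y (tangentCoord x y v) (tangentCoord x y w) = g.inner y v w := by
  rw [metricCoord_apply g hy, tangentCoordSymm_tangentCoord hy, tangentCoordSymm_tangentCoord hy]

theorem mdifferentiableAt_metricCoord (x : B) :
    MDifferentiableAt 𝓘(ℝ, E) 𝓘(ℝ, E →L[ℝ] E →L[ℝ] ℝ) (metricCoord g x) x :=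
  (mdifferentiableAt_section _ (fun y => g.inner y)).1 (g.contMDiff.mdifferentiableAt (by simp))

section Along

variable {G H : Type*} [NormedAddCommGroup G] [NormedSpace ℝ G] [TopologicalSpace H]
  {I : ModelWithCorners ℝ G H} {M : Type*} [TopologicalSpace M] [ChartedSpace H M]
  {ι : M → B} {V W : ∀ y, TangentSpace 𝓘(ℝ, E) (ι y)} {x : M}

theorem metric_along_eventuallyEq (hι : ContinuousAt ι x)
    (V W : ∀ y, TangentSpace 𝓘(ℝ, E) (ι y)) :
    (fun y => g.inner (ι y) (V y) (W y)) =ᶠ[𝓝 x] fun y =>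
      metricCoord g (ι x) (ι y) (tangentCoord (ι x) (ι y) (V y))
        (tangentCoord (ι x) (ι y) (W y)) := by
  filter_upwards [hι (coordDomain_mem_nhds (E := E) (ι x))] with y hy
  exact (metricCoord_tangentCoord g hy _ _).symm

theorem mdifferentiableAt_metric_along
    (hV : MDifferentiableAt I 𝓘(ℝ, E).tangent (vectorAlong ι V) x)
    (hW : MDifferentiableAt I 𝓘(ℝ, E).tangent (vectorAlong ι W) x) :
    MDifferentiableAt I 𝓘(ℝ, ℝ) (fun y => g.inner (ι y) (V y) (W y)) x := by
  rw [mdifferentiableAt_vectorAlong_iff] at hV hW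
  exact ((((mdifferentiableAt_metricCoord g (ι x)).comp x hV.1).clm_apply hV.2).clm_apply
    hW.2).congr_of_eventuallyEq (metric_along_eventuallyEq g hV.1.continuousAt V W)

theorem mdifferentiableAt_extend_along (hι : MDifferentiableAt I 𝓘(ℝ, E) ι x)
    (v : TangentSpace 𝓘(ℝ, E) (ι x)) :
    MDifferentiableAt I 𝓘(ℝ, E).tangent (vectorAlong ι fun y => extend E v (ι y)) x :=
  (mdifferentiableAt_extend 𝓘(ℝ, E) E v).comp x hι

end Along

variable [FiniteDimensional ℝ E] {g}

theorem WeylSpace.exists_mvfderiv_metricCoord (S : WeylSpace E B)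
    (hg : ∀ x, g.inner x ∈ S.conf x) (x : B) :
    ∃ α : TangentSpace 𝓘(ℝ, E) x → ℝ, ∀ X U W : TangentSpace 𝓘(ℝ, E) x,
      mvfderiv 𝓘(ℝ, E) (metricCoord g x) x X (tangentCoord x x U) (tangentCoord x x W) =
        α X * g.inner x U W + g.inner x (christoffel S.conn x X U) W +
          g.inner x U (christoffel S.conn x X W) := by
  obtain ⟨α, hα⟩ := S.conformal g hg
  refine ⟨α x, fun X U W => ?_⟩
  have hderiv := hα x (extend E U) (extend E W) X (mdifferentiableAt_extend 𝓘(ℝ, E) E U)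
    (mdifferentiableAt_extend 𝓘(ℝ, E) E W)
  have hcoord : (fun y => g.inner y (extend E U y) (extend E W y)) =ᶠ[𝓝 x]
      fun y => metricCoord g x y (tangentCoord x x U) (tangentCoord x x W) := by
    filter_upwards [coordDomain_mem_nhds (E := E) x] with y hy
    rw [← metricCoord_tangentCoord g hy, tangentCoord_extend hy, tangentCoord_extend hy]
  have hg' := mdifferentiableAt_metricCoord g x
  rw [mvfderiv_eq_of_eventuallyEq hcoord,
    mvfderiv_apply_const (hg'.clm_apply mdifferentiableAt_const), mvfderiv_apply_const hg',
    extend_apply_self, extend_apply_self] at hderiv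
  exact hderiv

variable {E' : Type*} [NormedAddCommGroup E'] [NormedSpace ℝ E']
  {M : Type*} [TopologicalSpace M] [ChartedSpace E' M] {ι : M → B} {x : M}

theorem WeylSpace.exists_mvfderiv_metric_along (S : WeylSpace E B)
    (hg : ∀ x, g.inner x ∈ S.conf x) (hι : MDifferentiableAt 𝓘(ℝ, E') 𝓘(ℝ, E) ι x) :
    ∃ α : TangentSpace 𝓘(ℝ, E') x → ℝ, ∀ V W : ∀ y, TangentSpace 𝓘(ℝ, E) (ι y),
      MDifferentiableAt 𝓘(ℝ, E') 𝓘(ℝ, E).tangent (vectorAlong ι V) x →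
      MDifferentiableAt 𝓘(ℝ, E') 𝓘(ℝ, E).tangent (vectorAlong ι W) x →
      ∀ X, mvfderiv 𝓘(ℝ, E') (fun y => g.inner (ι y) (V y) (W y)) x X =
        α X * g.inner (ι x) (V x) (W x) +
          g.inner (ι x) (pullbackDeriv S.conn ι V x X) (W x) +
          g.inner (ι x) (V x) (pullbackDeriv S.conn ι W x X) := by
  obtain ⟨α, hα⟩ := S.exists_mvfderiv_metricCoord hg (ι x)
  refine ⟨fun X => α (dif E E' ι x X), fun V W hV hW X => ?_⟩
  rw [mdifferentiableAt_vectorAlong_iff] at hV hW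
  have hg' := mdifferentiableAt_metricCoord g (ι x)
  have hgι : MDifferentiableAt 𝓘(ℝ, E') 𝓘(ℝ, E →L[ℝ] E →L[ℝ] ℝ)
      (fun y => metricCoord g (ι x) (ι y)) x := hg'.comp x hι
  have hchain : mvfderiv 𝓘(ℝ, E') (fun y => metricCoord g (ι x) (ι y)) x X =
      mvfderiv 𝓘(ℝ, E) (metricCoord g (ι x)) (ι x) (dif E E' ι x X) :=
    mfderiv_comp_apply x hg' hι X
  rw [mvfderiv_eq_of_eventuallyEq (metric_along_eventuallyEq g hι.continuousAt V W),
    mvfderiv_clm_apply (hgι.clm_apply hV.2) hW.2, mvfderiv_clm_apply hgι hV.2, hchain, add_apply,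
    hα, pullbackDeriv_eq S.conn hι.continuousAt, pullbackDeriv_eq S.conn hι.continuousAt,
    metricCoord_apply g (mem_coordDomain _), metricCoord_apply g (mem_coordDomain _)]
  simp only [tangentCoordSymm_tangentCoord_self, map_add, add_apply]
  ring

theorem pullbackDeriv_neg (D : CovariantDerivative 𝓘(ℝ, E) E (fun x : B => TangentSpace 𝓘(ℝ, E) x))
    (hι : ContinuousAt ι x) (V : ∀ y, TangentSpace 𝓘(ℝ, E) (ι y)) (X : TangentSpace 𝓘(ℝ, E') x) :
    pullbackDeriv D ι (fun y => -V y) x X = -pullbackDeriv D ι V x X := by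
  have hcoord : (fun y => tangentCoord (ι x) (ι y) (-V y)) =
      -fun y => tangentCoord (ι x) (ι y) (V y) := by
    ext y; exact map_neg _ _
  rw [pullbackDeriv_eq D hι, pullbackDeriv_eq D hι, hcoord, mvfderiv_neg]
  simp only [neg_apply, map_neg]
  abel

variable {F : ∀ y, TangentEnd E (ι y)}

theorem endDeriv_cube (D : CovariantDerivative 𝓘(ℝ, E) E (fun x : B => TangentSpace 𝓘(ℝ, E) x))
    (hF : MDifferentiableAt 𝓘(ℝ, E') (endModel E) (endAlong ι F) x)
    (hcube : ∀ y v, F y (F y (F y v)) + F y v = 0) (X : TangentSpace 𝓘(ℝ, E') x)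
    (v : TangentSpace 𝓘(ℝ, E) (ι x)) :
    F x (F x (endDeriv D ι F x X v)) + F x (endDeriv D ι F x X (F x v)) +
      endDeriv D ι F x X (F x (F x v)) + endDeriv D ι F x X v = 0 := by
  have hι : MDifferentiableAt 𝓘(ℝ, E') 𝓘(ℝ, E) ι x := (mdifferentiableAt_endTotal_iff.1 hF).1
  have hV := mdifferentiableAt_extend_along hι v
  have hFV := mdifferentiableAt_vectorAlong_apply hF hV
  have hFFV := mdifferentiableAt_vectorAlong_apply hF hFV
  have hleibniz := pullbackDeriv_apply D hF hFFV X
  have hcubeV : (fun y => F y (F y (F y (extend E v (ι y))))) =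
      fun y => -F y (extend E v (ι y)) :=
    funext fun y => eq_neg_of_add_eq_zero_left (hcube y _)
  rw [hcubeV, pullbackDeriv_neg D hι.continuousAt, pullbackDeriv_apply D hF hFV,
    pullbackDeriv_apply D hF hV] at hleibniz
  simp only [extend_apply_self, map_add] at hleibniz
  rw [eq_neg_of_add_eq_zero_left (hcube x _), neg_eq_iff_add_eq_zero] at hleibniz
  rw [← hleibniz]
  abel

theorem isSkew_endDeriv (S : WeylSpace E B)
    (hF : MDifferentiableAt 𝓘(ℝ, E') (endModel E) (endAlong ι F) x)
    (hskew : ∀ y, IsSkew (S.conf (ι y)) (F y)) (X : TangentSpace 𝓘(ℝ, E') x) :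
    IsSkew (S.conf (ι x)) (endDeriv S.conn ι F x X) := by
  obtain ⟨g, hg⟩ := S.exists_metric
  have hgS : ∀ y, g.inner y ∈ S.conf y := fun y => by
    rw [hg]
    exact ⟨1, one_pos, (one_smul _ _).symm⟩
  have hι : MDifferentiableAt 𝓘(ℝ, E') 𝓘(ℝ, E) ι x := (mdifferentiableAt_endTotal_iff.1 hF).1
  obtain ⟨α, hα⟩ := S.exists_mvfderiv_metric_along hgS hι
  suffices h : ∀ v w, g.inner (ι x) (endDeriv S.conn ι F x X v) w +
      g.inner (ι x) v (endDeriv S.conn ι F x X w) = 0 by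
    intro b hb v w
    rw [hg] at hb
    obtain ⟨t, -, rfl⟩ := hb
    simp only [smul_apply, smul_eq_mul]
    rw [← mul_add, h, mul_zero]
  intro v w
  have hV := mdifferentiableAt_extend_along hι v
  have hW := mdifferentiableAt_extend_along hι w
  have hFV := mdifferentiableAt_vectorAlong_apply hF hV
  have hFW := mdifferentiableAt_vectorAlong_apply hF hW
  have hzero : (fun y => g.inner (ι y) (F y (extend E v (ι y))) (extend E w (ι y))) +
      (fun y => g.inner (ι y) (extend E v (ι y)) (F y (extend E w (ι y)))) = fun _ => (0 : ℝ) :=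
    funext fun y => hskew y _ (hgS (ι y)) _ _
  have hderiv := congrArg (fun f => mvfderiv 𝓘(ℝ, E') f x X) hzero
  rw [mvfderiv_add (mdifferentiableAt_metric_along g hFV hW)
    (mdifferentiableAt_metric_along g hV hFW), mvfderiv_const, add_apply, zero_apply,
    hα _ _ hFV hW, hα _ _ hV hFW, pullbackDeriv_apply _ hF hV, pullbackDeriv_apply _ hF hW]
    at hderiv
  simp only [extend_apply_self, map_add, add_apply] at hderiv
  have hskewx := hskew x _ (hgS (ι x))
  linear_combination hderiv - α X * hskewx v w -
    hskewx v (pullbackDeriv S.conn ι (fun y => extend E w (ι y)) x X) -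
    hskewx (pullbackDeriv S.conn ι (fun y => extend E v (ι y)) x X) w

theorem endDeriv_mem_fibreTangent (S : WeylSpace E B)
    (hF : MDifferentiableAt 𝓘(ℝ, E') (endModel E) (endAlong ι F) x)
    (hskew : ∀ y, IsSkew (S.conf (ι y)) (F y)) (hcube : ∀ y v, F y (F y (F y v)) + F y v = 0)
    (X : TangentSpace 𝓘(ℝ, E') x) :
    endDeriv S.conn ι F x X ∈ fibreTangent (S.conf (ι x)) (F x) :=
  mem_fibreTangent_of_isSkew (hskew x) (isSkew_endDeriv S hF hskew X) (hcube x)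
    (endDeriv_cube S.conn hF hcube X)

end Fibre

/-! ### Submanifolds of Weyl spaces -/

section ConformalClass

variable {U V : Type*} [AddCommGroup U] [Module ℝ U] [TopologicalSpace U]
  [AddCommGroup V] [Module ℝ V] [TopologicalSpace V] {c : Set (V →L[ℝ] V →L[ℝ] ℝ)}

/-- The pull back of a bilinear form by a linear map. -/
def pullbackForm (L : U →L[ℝ] V) (b : V →L[ℝ] V →L[ℝ] ℝ) : U →L[ℝ] U →L[ℝ] ℝ :=
  L.precomp ℝ ∘L b ∘L L

theorem IsConformalClass.symm (hc : IsConformalClass c) {b : V →L[ℝ] V →L[ℝ] ℝ} (hb : b ∈ c)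
    (v w : V) : b v w = b w v := by
  obtain ⟨g, hsymm, -, rfl⟩ := hc
  obtain ⟨t, -, rfl⟩ := hb
  simp only [smul_apply, hsymm v w]

theorem IsConformalClass.comap (hc : IsConformalClass c) {L : U →L[ℝ] V}
    (hL : Function.Injective L) :
    IsConformalClass {b' : U →L[ℝ] U →L[ℝ] ℝ | ∃ b ∈ c, ∀ v w, b' v w = b (L v) (L w)} := by
  obtain ⟨g, hsymm, hpos, rfl⟩ := hc
  refine ⟨pullbackForm L g, fun v w => hsymm _ _,
    fun v hv => hpos _ ((map_ne_zero_iff L hL).2 hv), Set.ext fun b' => ⟨?_, ?_⟩⟩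
  · rintro ⟨_, ⟨t, ht, rfl⟩, hb'⟩
    exact ⟨t, ht, ContinuousLinearMap.ext fun v => ContinuousLinearMap.ext fun w => hb' v w⟩
  · rintro ⟨t, ht, rfl⟩
    exact ⟨t • g, ⟨t, ht, rfl⟩, fun _ _ => rfl⟩

end ConformalClass

section Differentiability

variable {G H : Type*} [NormedAddCommGroup G] [NormedSpace ℝ G] [TopologicalSpace H]
  {I : ModelWithCorners ℝ G H} {M : Type*} [TopologicalSpace M] [ChartedSpace H M]
  {F₁ F₂ F₃ : Type*} [NormedAddCommGroup F₁] [NormedSpace ℝ F₁]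
  [NormedAddCommGroup F₂] [NormedSpace ℝ F₂] [CompleteSpace F₂]
  [NormedAddCommGroup F₃] [NormedSpace ℝ F₃]

/- Near `x` the operators `P ∘ A y` are invertible, hence `K y = (P ∘ A y)⁻¹ ∘ P ∘ C y`. -/
theorem mdifferentiableAt_of_clm_comp_eq {A : M → F₂ →L[ℝ] F₃} {C : M → F₁ →L[ℝ] F₃}
    {K : M → F₁ →L[ℝ] F₂} {x : M} {P : F₃ →L[ℝ] F₂} (hP : P ∘L A x = 1)
    (hA : MDifferentiableAt I 𝓘(ℝ, F₂ →L[ℝ] F₃) A x)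
    (hC : MDifferentiableAt I 𝓘(ℝ, F₁ →L[ℝ] F₃) C x) (hAK : ∀ᶠ y in 𝓝 x, A y ∘L K y = C y) :
    MDifferentiableAt I 𝓘(ℝ, F₁ →L[ℝ] F₂) K x := by
  have hPA : MDifferentiableAt I 𝓘(ℝ, F₂ →L[ℝ] F₂) (fun y => P ∘L A y) x :=
    mdifferentiableAt_const.clm_comp hA
  have hinv : MDifferentiableAt I 𝓘(ℝ, F₂ →L[ℝ] F₂) (fun y => Ring.inverse (P ∘L A y)) x := by
    refine DifferentiableAt.comp_mdifferentiableAt (g := Ring.inverse) ?_ hPA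
    rw [hP]
    exact differentiableAt_inverse isUnit_one
  have hunit : ∀ᶠ y in 𝓝 x, IsUnit (P ∘L A y) := by
    refine hPA.continuousAt.eventually ?_
    change ∀ᶠ T in 𝓝 (P ∘L A x), IsUnit T
    rw [hP]
    exact Units.nhds 1
  refine (hinv.clm_comp (mdifferentiableAt_const.clm_comp hC)).congr_of_eventuallyEq
    (f := fun y => Ring.inverse (P ∘L A y) ∘L (P ∘L C y)) ?_
  filter_upwards [hunit, hAK] with y hy hAKy
  rw [← hAKy, ← ContinuousLinearMap.comp_assoc, ← ContinuousLinearMap.comp_assoc]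
  exact (congrArg (· ∘L K y) (Ring.inverse_mul_cancel _ hy)).symm

variable {E : Type*} [NormedAddCommGroup E] [NormedSpace ℝ E]
  {N : Type*} [TopologicalSpace N] [ChartedSpace E N] [IsManifold 𝓘(ℝ, E) ∞ N]
  {E' : Type*} [NormedAddCommGroup E'] [NormedSpace ℝ E']
  {M : Type*} [TopologicalSpace M] [ChartedSpace E' M] [IsManifold 𝓘(ℝ, E') ∞ M]
  {ι : M → N} {F : ∀ y, TangentEnd E (ι y)} {J : ∀ y : M, TangentEnd E' y} {x : M}

theorem mdifferentiableAt_difCoord (hι : ContMDiff 𝓘(ℝ, E') 𝓘(ℝ, E) ∞ ι) :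
    MDifferentiableAt 𝓘(ℝ, E') 𝓘(ℝ, E' →L[ℝ] E)
      (fun y => tangentCoord (ι x) (ι y) ∘L dif E E' ι y ∘L tangentCoordSymm x y) x :=
  (hι.contMDiffAt.mfderiv_const (m := 1) (by norm_cast)).mdifferentiableAt one_ne_zero

theorem mdifferentiableAt_endAlong_of_comm [CompleteSpace E']
    (hι : ContMDiff 𝓘(ℝ, E') 𝓘(ℝ, E) ∞ ι)
    {P : TangentSpace 𝓘(ℝ, E) (ι x) →L[ℝ] TangentSpace 𝓘(ℝ, E') x}
    (hP : ∀ u, P (dif E E' ι x u) = u)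
    (hJF : ∀ y v, F y (dif E E' ι y v) = dif E E' ι y (J y v))
    (hF : MDifferentiableAt 𝓘(ℝ, E') (endModel E) (endAlong ι F) x) :
    MDifferentiableAt 𝓘(ℝ, E') (endModel E') (endAlong (fun y => y) J) x := by
  obtain ⟨hιx, hFcoord⟩ := mdifferentiableAt_endTotal_iff.1 hF
  have hA := mdifferentiableAt_difCoord (x := x) hι
  refine mdifferentiableAt_endTotal_iff.2 ⟨mdifferentiableAt_id, mdifferentiableAt_of_clm_comp_eq
    (P := tangentCoord x x ∘L P ∘L tangentCoordSymm (ι x) (ι x)) ?_ hA (hFcoord.clm_comp hA) ?_⟩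
  · ext u
    simp only [ContinuousLinearMap.comp_apply, tangentCoordSymm_tangentCoord_self, hP,
      tangentCoord_tangentCoordSymm_self, one_apply_eq_self]
  · filter_upwards [coordDomain_mem_nhds (E := E') x,
      hιx.continuousAt (coordDomain_mem_nhds (E := E) (ι x))] with y hyx hyι
    ext u
    simp only [endCoord, ContinuousLinearMap.comp_apply, tangentCoordSymm_tangentCoord hyx,
      tangentCoordSymm_tangentCoord hyι, hJF]

end Differentiability

section Submanifolds

variable {E : Type*} [NormedAddCommGroup E] [NormedSpace ℝ E] [FiniteDimensional ℝ E]
  {N : Type*} [TopologicalSpace N] [ChartedSpace E N] [IsManifold 𝓘(ℝ, E) ∞ N]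
  {E' : Type*} [NormedAddCommGroup E'] [NormedSpace ℝ E']
  {M : Type*} [TopologicalSpace M] [ChartedSpace E' M]
  {S : WeylSpace E N} {ι : M → N}

theorem isConformalClass_inducedConf (hι : IsSubmanifold E E' ι) (S : WeylSpace E N) (x : M) :
    IsConformalClass (inducedConf (E' := E') S.conf ι x) :=
  (S.isConformalClass (ι x)).comap (hι.immersive x)

variable [FiniteDimensional ℝ E'] [IsManifold 𝓘(ℝ, E') ∞ M] (hι : IsSubmanifold E E' ι) {x : M}

theorem tangentialPart_dif (x : M) (u : TangentSpace 𝓘(ℝ, E') x) :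
    tangentialPart S hι x (dif E E' ι x u) = u :=
  (exists_tangentialPart S hι x).choose_spec.1 u

theorem exists_inducedConf_adjoint
    {b : TangentSpace 𝓘(ℝ, E) (ι x) →L[ℝ] TangentSpace 𝓘(ℝ, E) (ι x) →L[ℝ] ℝ}
    (hb : b ∈ S.conf (ι x)) :
    ∃ b' ∈ inducedConf S.conf ι x,
      (∀ u v, b (dif E E' ι x u) v = b' u (tangentialPart S hι x v)) ∧
        ∀ v u, b v (dif E E' ι x u) = b' (tangentialPart S hι x v) u := by
  have hright : ∀ v u, b v (dif E E' ι x u) =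
      b (dif E E' ι x (tangentialPart S hι x v)) (dif E E' ι x u) := fun v u => by
    rw [← sub_eq_zero, ← sub_apply, ← map_sub]
    exact (exists_tangentialPart S hι x).choose_spec.2 b hb v u
  refine ⟨pullbackForm (dif E E' ι x) b, ⟨b, hb, fun _ _ => rfl⟩, fun u v => ?_, hright⟩
  have hsymm := (S.isConformalClass (ι x)).symm hb
  rw [hsymm, hright, hsymm]
  rfl

theorem IsSkew.tangentialPart_comp {T : TangentEnd E (ι x)} (hT : IsSkew (S.conf (ι x)) T) :
    IsSkew (inducedConf S.conf ι x) (tangentialPart S hι x ∘L T ∘L dif E E' ι x) := by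
  rintro b' ⟨b, hb, hb'⟩ v w
  obtain ⟨b'', -, hleft, hright⟩ := exists_inducedConf_adjoint hι hb
  have heq : ∀ v w, b' v w = b'' v w := fun v w => by
    rw [hb', hleft, tangentialPart_dif]
  simp only [heq, ContinuousLinearMap.comp_apply, ← hleft, ← hright]
  exact hT b hb _ _

theorem secondFundamentalForm_eq {W : ∀ y : M, TangentSpace 𝓘(ℝ, E') y}
    (hW : MDiffAt (T% W) x) (X : TangentSpace 𝓘(ℝ, E') x) :
    secondFundamentalForm S hι x X (W x) =
      pullbackDeriv S.conn ι (fun y => dif E E' ι y (W y)) x X -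
        dif E E' ι x (inducedConn S hι W x X) := by
  have htensor : TensorialAt 𝓘(ℝ, E') E' (fun W : ∀ y : M, TangentSpace 𝓘(ℝ, E') y =>
      pullbackDeriv S.conn ι (fun y => dif E E' ι y (W y)) x X -
        dif E E' ι x (inducedConn S hι W x X)) x := by
    constructor
    · intro f σ hf hσ
      rw [pullbackDeriv_smul hι S.conn hσ hf,
        (inducedConn S hι).isCovariantDerivativeOnUniv.leibniz hσ hf]
      simp only [add_apply, smul_apply, ContinuousLinearMap.smulRight_apply, map_add, map_smul,
        smul_sub]
      abel
    · intro σ τ hσ hτ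
      rw [pullbackDeriv_add hι S.conn hσ hτ,
        (inducedConn S hι).isCovariantDerivativeOnUniv.add hσ hτ]
      simp only [add_apply, map_add]
      abel
  exact htensor.pointwise (mdifferentiableAt_extend 𝓘(ℝ, E') E' (W x)) hW (by simp)

theorem tangentialPart_secondFundamentalForm (X Y : TangentSpace 𝓘(ℝ, E') x) :
    tangentialPart S hι x (secondFundamentalForm S hι x X Y) = 0 := by
  rw [secondFundamentalForm, map_sub, tangentialPart_dif]
  exact sub_self _

variable {F : ∀ y, TangentEnd E (ι y)} {J : ∀ y : M, TangentEnd E' y}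
  (hFJ : ∀ y, F y = dif E E' ι y ∘L J y ∘L tangentialPart S hι y)

include hFJ

theorem apply_dif_of_eq_comp (y : M) (v : TangentSpace 𝓘(ℝ, E') y) :
    F y (dif E E' ι y v) = dif E E' ι y (J y v) := by
  simp only [hFJ, ContinuousLinearMap.comp_apply, tangentialPart_dif]

theorem mdifferentiableAt_endAlong_of_eq_comp
    (hF : MDifferentiableAt 𝓘(ℝ, E') (endModel E) (endAlong ι F) x) :
    MDifferentiableAt 𝓘(ℝ, E') (endModel E') (endAlong (fun y => y) J) x :=
  have := FiniteDimensional.complete ℝ E'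
  mdifferentiableAt_endAlong_of_comm hι.smooth (tangentialPart_dif (S := S) hι x)
    (apply_dif_of_eq_comp hι hFJ) hF

/-- The Gauss formula for the extension by zero, on the normal bundle, of a field of endomorphisms
of `TM`. -/
theorem endDeriv_dif (hF : MDifferentiableAt 𝓘(ℝ, E') (endModel E) (endAlong ι F) x)
    (X Y : TangentSpace 𝓘(ℝ, E') x) :
    endDeriv S.conn ι F x X (dif E E' ι x Y) =
      dif E E' ι x (endDeriv (inducedConn S hι) (fun y : M => y) J x X Y) +
        secondFundamentalForm S hι x X (J x Y) := by
  have hJ := mdifferentiableAt_endAlong_of_eq_comp hι hFJ hF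
  have hY := mdifferentiableAt_extend 𝓘(ℝ, E') E' Y
  have hJY := mdifferentiableAt_vectorAlong_apply hJ hY
  have hleibnizN := pullbackDeriv_apply S.conn hF (mdifferentiableAt_dif hι hY) X
  have hleibnizM := pullbackDeriv_apply (inducedConn S hι) hJ hY X
  have hgauss := secondFundamentalForm_eq (S := S) hι hJY X
  rw [pullbackDeriv_id _ hJY, pullbackDeriv_id _ hY] at hleibnizM
  simp only [apply_dif_of_eq_comp hι hFJ, extend_apply_self] at hleibnizN hleibnizM hgauss
  have htangential : F x (pullbackDeriv S.conn ι (fun y => dif E E' ι y (extend E' Y y)) x X) =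
      dif E E' ι x (J x (inducedConn S hι (extend E' Y) x X)) := by
    rw [hFJ]
    rfl
  rw [hgauss, hleibnizN, hleibnizM, htangential, map_add]
  abel

theorem tangentialPart_endDeriv_dif
    (hF : MDifferentiableAt 𝓘(ℝ, E') (endModel E) (endAlong ι F) x)
    (X Y : TangentSpace 𝓘(ℝ, E') x) :
    tangentialPart S hι x (endDeriv S.conn ι F x X (dif E E' ι x Y)) =
      endDeriv (inducedConn S hι) (fun y : M => y) J x X Y := by
  rw [endDeriv_dif hι hFJ hF, map_add, tangentialPart_dif, tangentialPart_secondFundamentalForm,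
    add_zero]

end Submanifolds

section HolomorphicSections

variable {E : Type*} [NormedAddCommGroup E] [NormedSpace ℝ E] [FiniteDimensional ℝ E]
  {N : Type*} [TopologicalSpace N] [ChartedSpace E N] [IsManifold 𝓘(ℝ, E) ∞ N]
  {E' : Type*} [NormedAddCommGroup E'] [NormedSpace ℝ E']
  {M : Type*} [TopologicalSpace M] [ChartedSpace E' M]
  {ι : M → N} {J : ∀ y : M, TangentEnd E' y}

theorem isHolomorphic_iff_endDeriv_dif
    {c : ∀ x : N, Set (TangentSpace 𝓘(ℝ, E) x →L[ℝ] TangentSpace 𝓘(ℝ, E) x →L[ℝ] ℝ)}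
    {D : CovariantDerivative 𝓘(ℝ, E) E (fun x : N => TangentSpace 𝓘(ℝ, E) x)}
    {F : ∀ y, TangentEnd E (ι y)}
    (hF : ∀ x, MDifferentiableAt 𝓘(ℝ, E') (endModel E) (endAlong ι F) x)
    (hfib : ∀ (x : M) (X : TangentSpace 𝓘(ℝ, E') x),
      endDeriv D ι F x X ∈ fibreTangent (c (ι x)) (F x))
    (hJ : ∀ x v, J x (J x v) = -v)
    (hFJ : ∀ x, minusI (F x) = (minusI (J x)).map (cx (dif E E' ι x))) :
    IsHolomorphic (endModel E) J (endAlong ι F) (distG' c D) ↔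
      ∀ x (X Y : TangentSpace 𝓘(ℝ, E') x), endDeriv D ι F x X (dif E E' ι x Y) +
        endDeriv D ι F x (J x X) (dif E E' ι x (J x Y)) = 0 := by
  have hcomm : ∀ (x : M) (v : TangentSpace 𝓘(ℝ, E') x),
      F x (dif E E' ι x v) = dif E E' ι x (J x v) := fun x v => by
    have hmem : cx (dif E E' ι x) ((1 : ℂ) ⊗ₜ[ℝ] v + Complex.I ⊗ₜ[ℝ] J x v) ∈ minusI (F x) := by
      rw [hFJ]
      exact Submodule.mem_map_of_mem (tmul_add_mem_minusI (hJ x) v)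
    simpa [reV_cx, imV_cx] using (mem_minusI.1 hmem).1
  refine (isHolomorphic_iff hF hfib hcomm).trans (forall_congr' fun x => ?_)
  rw [← forall_minusI_iff (hJ x) fun X Y => endDeriv D ι F x X (dif E E' ι x Y), hFJ]
  refine forall₂_congr fun Z _ => ?_
  simp only [Submodule.mem_map, forall_exists_index, and_imp, forall_apply_eq_imp_iff₂, reV_cx,
    imV_cx]

end HolomorphicSections

section TangentSections

variable {E : Type*} [NormedAddCommGroup E] [NormedSpace ℝ E]
  {N : Type*} [TopologicalSpace N] [ChartedSpace E N]
  {E' : Type*} [NormedAddCommGroup E'] [NormedSpace ℝ E']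
  {M : Type*} [TopologicalSpace M] [ChartedSpace E' M] {ι : M → N}
  {p : ∀ x : M, Submodule ℂ (ℂ ⊗[ℝ] TangentSpace 𝓘(ℝ, E) (ι x))} {x : M}

theorem map_tangentPlane (htan : p x ≤ LinearMap.range (cx (dif E E' ι x))) :
    (tangentPlane E' p x).map (cx (dif E E' ι x)) = p x :=
  Submodule.map_comap_eq_of_le htan

variable [FiniteDimensional ℝ E] [IsManifold 𝓘(ℝ, E) ∞ N] {S : WeylSpace E N}

theorem isIsotropic_tangentPlane (hp : IsIsotropic (S.conf (ι x)) (p x)) :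
    IsIsotropic (inducedConf (E' := E') S.conf ι x) (tangentPlane E' p x) := by
  rintro b' ⟨b, hb, hb'⟩ v hv w hw
  have hbvw := hp b hb _ hv _ hw
  rw [baseChange_re_im] at hbvw ⊢
  simpa only [reV_cx, imV_cx, hb'] using hbvw

variable [FiniteDimensional ℝ E']

theorem almostHermitian_spec (hι : IsSubmanifold E E' ι) (hp : IsIsotropic (S.conf (ι x)) (p x)) :
    IsFStructureOf (inducedConf S.conf ι x) (tangentPlane E' p x) (almostHermitian E' S p x) :=
  fStructure_spec (isConformalClass_inducedConf hι S x) (isIsotropic_tangentPlane hp)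

theorem almostHermitian_sq (hι : IsSubmanifold E E' ι) (hp : IsIsotropic (S.conf (ι x)) (p x))
    (hfr : Module.finrank ℝ E' = 2 * Module.finrank ℂ (p x))
    (htan : p x ≤ LinearMap.range (cx (dif E E' ι x))) (v : TangentSpace 𝓘(ℝ, E') x) :
    almostHermitian E' S p x (almostHermitian E' S p x v) = -v := by
  refine apply_apply_of_finrank_minusI ?_ v
  rw [(almostHermitian_spec hι hp).2.2, (Submodule.equivMapOfInjective _
    (cx_injective (hι.immersive x)) (tangentPlane E' p x)).finrank_eq, map_tangentPlane htan]
  exact hfr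

theorem isHolomorphic_isoPoint_iff (hι : IsSubmanifold E E' ι)
    (hp : ∀ x, IsIsotropic (S.conf (ι x)) (p x))
    (hsm : ∀ x, MDifferentiableAt 𝓘(ℝ, E') (endModel E)
      (fun y => isoPoint S.conf (ι y) (p y)) x)
    (hfr : ∀ x, Module.finrank ℝ E' = 2 * Module.finrank ℂ (p x))
    (htan : ∀ x, p x ≤ LinearMap.range (cx (dif E E' ι x))) :
    IsHolomorphic (endModel E) (almostHermitian E' S p)
        (fun x => isoPoint S.conf (ι x) (p x)) (distG' S.conf S.conn) ↔
      ∀ x (X Y : TangentSpace 𝓘(ℝ, E') x),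
        endDeriv S.conn ι (fun y => fStructure (S.conf (ι y)) (p y)) x X (dif E E' ι x Y) +
          endDeriv S.conn ι (fun y => fStructure (S.conf (ι y)) (p y)) x
            (almostHermitian E' S p x X) (dif E E' ι x (almostHermitian E' S p x Y)) = 0 := by
  have hspec x := fStructure_spec (S.isConformalClass (ι x)) (hp x)
  refine isHolomorphic_iff_endDeriv_dif hsm (fun x => endDeriv_mem_fibreTangent S (hsm x)
    (fun y => (hspec y).1) fun y => (hspec y).2.1)
    (fun x => almostHermitian_sq hι (hp x) (hfr x) (htan x)) fun x => ?_
  rw [(hspec x).2.2, (almostHermitian_spec hι (hp x)).2.2, map_tangentPlane (htan x)]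

variable [IsManifold 𝓘(ℝ, E') ∞ M] (hι : IsSubmanifold E E' ι)

theorem fStructure_eq_comp (hp : IsIsotropic (S.conf (ι x)) (p x))
    (htan : p x ≤ LinearMap.range (cx (dif E E' ι x))) :
    fStructure (S.conf (ι x)) (p x) =
      dif E E' ι x ∘L almostHermitian E' S p x ∘L tangentialPart S hι x := by
  have hconj := isFStructureOf_conj (tangentialPart_dif (S := S) hι x)
    (fun b hb => exists_inducedConf_adjoint hι hb) (almostHermitian_spec hι hp)
  rw [map_tangentPlane htan] at hconj
  exact (existsUnique_isFStructureOf (S.isConformalClass (ι x)) hp).unique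
    (fStructure_spec (S.isConformalClass (ι x)) hp) hconj

theorem isOneOneGeodesic_iff {J : ∀ y : M, TangentEnd E' y} (hJ : ∀ x v, J x (J x v) = -v) :
    IsOneOneGeodesic S hι J ↔ ∀ x (X Y : TangentSpace 𝓘(ℝ, E') x),
      secondFundamentalForm S hι x X (J x Y) +
        secondFundamentalForm S hι x (J x X) (J x (J x Y)) = 0 := by
  refine forall₂_congr fun x X => ?_
  have hsurj : Function.Surjective (J x) := fun Y => ⟨-J x Y, by rw [map_neg, hJ, neg_neg]⟩
  simp only [smul_eq_zero_iff_right (inv_ne_zero (two_ne_zero (α := ℝ)))]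
  exact hsurj.forall

section Along

variable {F : ∀ y, TangentEnd E (ι y)} {J : ∀ y : M, TangentEnd E' y}
  (hFJ : ∀ y, F y = dif E E' ι y ∘L J y ∘L tangentialPart S hι y)

include hFJ

theorem endDeriv_inducedConn_mem_fibreTangent (hskew : ∀ y, IsSkew (S.conf (ι y)) (F y))
    (hskew' : ∀ y, IsSkew (inducedConf S.conf ι y) (J y))
    (hcube : ∀ y v, J y (J y (J y v)) + J y v = 0)
    (hF : MDifferentiableAt 𝓘(ℝ, E') (endModel E) (endAlong ι F) x)
    (X : TangentSpace 𝓘(ℝ, E') x) :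
    endDeriv (inducedConn S hι) (fun y : M => y) J x X ∈
      fibreTangent (inducedConf S.conf ι x) (J x) := by
  have htangential : endDeriv (inducedConn S hι) (fun y : M => y) J x X =
      tangentialPart S hι x ∘L endDeriv S.conn ι F x X ∘L dif E E' ι x :=
    ContinuousLinearMap.ext fun Y => (tangentialPart_endDeriv_dif hι hFJ hF X Y).symm
  refine mem_fibreTangent_of_isSkew (hskew' x) ?_ (hcube x)
    (endDeriv_cube _ (mdifferentiableAt_endAlong_of_eq_comp hι hFJ hF) hcube X)
  rw [htangential]
  exact (isSkew_endDeriv S hF hskew X).tangentialPart_comp hι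

theorem forall_endDeriv_dif_eq_zero_iff (hJ : ∀ x v, J x (J x v) = -v)
    (hF : ∀ x, MDifferentiableAt 𝓘(ℝ, E') (endModel E) (endAlong ι F) x) :
    (∀ x (X Y : TangentSpace 𝓘(ℝ, E') x), endDeriv S.conn ι F x X (dif E E' ι x Y) +
        endDeriv S.conn ι F x (J x X) (dif E E' ι x (J x Y)) = 0) ↔
      IsOneOneGeodesic S hι J ∧ ∀ x (X Y : TangentSpace 𝓘(ℝ, E') x),
        endDeriv (inducedConn S hι) (fun y : M => y) J x X Y +
          endDeriv (inducedConn S hι) (fun y : M => y) J x (J x X) (J x Y) = 0 := by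
  rw [isOneOneGeodesic_iff hι hJ]
  simp only [← forall_and]
  refine forall₃_congr fun x X Y => ?_
  have hgauss : endDeriv S.conn ι F x X (dif E E' ι x Y) +
        endDeriv S.conn ι F x (J x X) (dif E E' ι x (J x Y)) =
      dif E E' ι x (endDeriv (inducedConn S hι) (fun y : M => y) J x X Y +
        endDeriv (inducedConn S hι) (fun y : M => y) J x (J x X) (J x Y)) +
      (secondFundamentalForm S hι x X (J x Y) +
        secondFundamentalForm S hι x (J x X) (J x (J x Y))) := by
    rw [endDeriv_dif hι hFJ (hF x), endDeriv_dif hι hFJ (hF x), map_add]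
    abel
  refine ⟨fun h => ?_, fun ⟨hnormal, htangential⟩ => ?_⟩
  · have htangential : endDeriv (inducedConn S hι) (fun y : M => y) J x X Y +
        endDeriv (inducedConn S hι) (fun y : M => y) J x (J x X) (J x Y) = 0 := by
      simpa only [map_add (tangentialPart S hι x), tangentialPart_endDeriv_dif hι hFJ (hF x),
        map_zero] using congrArg (tangentialPart S hι x) h
    rw [htangential, map_zero, zero_add, h] at hgauss
    exact ⟨hgauss.symm, htangential⟩
  · rw [hgauss, hnormal, htangential, map_zero, zero_add]

end Along

theorem isHolomorphic_isoPoint_tangentPlane_iff (hp : ∀ x, IsIsotropic (S.conf (ι x)) (p x))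
    (hsm : ∀ x, MDifferentiableAt 𝓘(ℝ, E') (endModel E)
      (fun y => isoPoint S.conf (ι y) (p y)) x)
    (hfr : ∀ x, Module.finrank ℝ E' = 2 * Module.finrank ℂ (p x))
    (htan : ∀ x, p x ≤ LinearMap.range (cx (dif E E' ι x))) :
    IsHolomorphic (endModel E') (almostHermitian E' S p)
        (fun x => isoPoint (inducedConf S.conf ι) x (tangentPlane E' p x))
        (distG' (inducedConf S.conf ι) (inducedConn S hι)) ↔
      ∀ x (X Y : TangentSpace 𝓘(ℝ, E') x),
        endDeriv (inducedConn S hι) (fun y : M => y) (almostHermitian E' S p) x X Y +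
          endDeriv (inducedConn S hι) (fun y : M => y) (almostHermitian E' S p) x
            (almostHermitian E' S p x X) (almostHermitian E' S p x Y) = 0 := by
  have hspec x := almostHermitian_spec hι (hp x)
  have hFJ x := fStructure_eq_comp hι (hp x) (htan x)
  have hdif (x : M) : cx (dif E' E' (fun y : M => y) x) = LinearMap.id :=
    LinearMap.ext fun z => ext_reV_imV (by simp [reV_cx, dif_id]) (by simp [imV_cx, dif_id])
  refine (isHolomorphic_iff_endDeriv_dif (ι := fun y : M => y)
    (fun x => mdifferentiableAt_endAlong_of_eq_comp hι hFJ (hsm x))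
    (fun x => endDeriv_inducedConn_mem_fibreTangent hι hFJ
      (fun y => (fStructure_spec (S.isConformalClass (ι y)) (hp y)).1)
      (fun y => (hspec y).1) (fun y => (hspec y).2.1) (hsm x))
    (fun x => almostHermitian_sq hι (hp x) (hfr x) (htan x)) fun x => ?_).trans ?_
  · rw [hdif, Submodule.map_id]
  · simp only [dif_id]

end TangentSections

end WeylTwistor

end

open WeylTwistor in
theorem proposition4p2_general
    {E : Type*} [NormedAddCommGroup E] [NormedSpace ℝ E] [FiniteDimensional ℝ E]
    {N : Type*} [TopologicalSpace N] [ChartedSpace E N] [IsManifold 𝓘(ℝ, E) ∞ N]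
    {E' : Type*} [NormedAddCommGroup E'] [NormedSpace ℝ E'] [FiniteDimensional ℝ E']
    {M : Type*} [TopologicalSpace M] [ChartedSpace E' M] [IsManifold 𝓘(ℝ, E') ∞ M]
    {S : WeylSpace E N} {ι : M → N} (hι : IsSubmanifold E E' ι)
    {p : ∀ x : M, Submodule ℂ (ℂ ⊗[ℝ] TangentSpace 𝓘(ℝ, E) (ι x))}
    (hp : ∀ x, IsIsotropic (S.conf (ι x)) (p x))
    (hsm : ∀ x, MDifferentiableAt 𝓘(ℝ, E') (endModel E)
      (fun y => isoPoint S.conf (ι y) (p y)) x)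
    (hfr : ∀ x, Module.finrank ℝ E' = 2 * Module.finrank ℂ (p x))
    (htan : ∀ x, p x ≤ LinearMap.range (cx (dif E E' ι x))) :
    IsHolomorphic (endModel E) (almostHermitian E' S p)
        (fun x => isoPoint S.conf (ι x) (p x)) (distG' S.conf S.conn) ↔
      IsOneOneGeodesic S hι (almostHermitian E' S p) ∧
        IsHolomorphic (endModel E') (almostHermitian E' S p)
          (fun x => isoPoint (inducedConf S.conf ι) x (tangentPlane E' p x))
          (distG' (inducedConf S.conf ι) (inducedConn S hι)) := by
  rw [isHolomorphic_isoPoint_iff hι hp hsm hfr htan,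
    isHolomorphic_isoPoint_tangentPlane_iff hι hp hsm hfr htan]
  exact forall_endDeriv_dif_eq_zero_iff hι (fun x => fStructure_eq_comp hι (hp x) (htan x))
    (fun x => almostHermitian_sq hι (hp x) (hfr x) (htan x)) hsm

theorem proposition4p2 {n r : ℕ} (hr : 1 ≤ r) (hrn : 2 * r < n)
    {N : Type*} [TopologicalSpace N] [T2Space N] [SigmaCompactSpace N]
    [ChartedSpace (EuclideanSpace ℝ (Fin n)) N] [IsManifold (𝓡 n) ∞ N]
    {M : Type*} [TopologicalSpace M] [T2Space M] [SigmaCompactSpace M]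
    [ChartedSpace (EuclideanSpace ℝ (Fin (2 * r))) M] [IsManifold (𝓡 (2 * r)) ∞ M]
    (S : WeylTwistor.WeylSpace (EuclideanSpace ℝ (Fin n)) N)
    (ι : M → N)
    (hι : WeylTwistor.IsSubmanifold (EuclideanSpace ℝ (Fin n))
      (EuclideanSpace ℝ (Fin (2 * r))) ι)
    (p : ∀ x : M, Submodule ℂ (ℂ ⊗[ℝ] TangentSpace (𝓡 n) (ι x)))
    (hp : WeylTwistor.IsIsotropicSection S (EuclideanSpace ℝ (Fin (2 * r))) ι r p)
    (htan : ∀ x, p x ≤ LinearMap.range (WeylTwistor.cx (mfderiv (𝓡 (2 * r)) (𝓡 n) ι x)))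
    (o : ∀ x : M, Orientation ℝ (TangentSpace (𝓡 (2 * r)) x) (Fin (2 * r)))
    (ho : WeylTwistor.IsOrientation (EuclideanSpace ℝ (Fin (2 * r))) o)
    (hpos : ∀ x, WeylTwistor.IsPositive (o x)
      (WeylTwistor.almostHermitian (EuclideanSpace ℝ (Fin (2 * r))) S p x)) :
    WeylTwistor.IsHolomorphic
        (WeylTwistor.endModel (EuclideanSpace ℝ (Fin n)))
        (WeylTwistor.almostHermitian (EuclideanSpace ℝ (Fin (2 * r))) S p)
        (fun x => WeylTwistor.isoPoint S.conf (ι x) (p x))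
        (WeylTwistor.distG' S.conf S.conn) ↔
      WeylTwistor.IsOneOneGeodesic S hι
          (WeylTwistor.almostHermitian (EuclideanSpace ℝ (Fin (2 * r))) S p) ∧
        WeylTwistor.IsHolomorphic
          (WeylTwistor.endModel (EuclideanSpace ℝ (Fin (2 * r))))
          (WeylTwistor.almostHermitian (EuclideanSpace ℝ (Fin (2 * r))) S p)
          (fun x => WeylTwistor.isoPoint (WeylTwistor.inducedConf S.conf ι) x
            (WeylTwistor.tangentPlane (EuclideanSpace ℝ (Fin (2 * r))) p x))
          (WeylTwistor.distG' (WeylTwistor.inducedConf S.conf ι)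
            (WeylTwistor.inducedConn S hι)) := by
  refine proposition4p2_general hι hp.isotropic
    (fun x => (hp.smooth x).mdifferentiableAt (by simp)) (fun x => ?_) htan
  rw [hp.finrank x, finrank_euclideanSpace_fin]
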